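/- \textbf{Theorem.} Let $G_n$ be the complete directed graph without loops on $n$ nodes, let $E_n$ be its set of $n(n-1)$ arcs, and let $\mathcal T_n$ be the set of its tours (directed Hamiltonian cycles). For a real $n(n-1)\times n(n-1)$ matrix $Q=(q_{ef})_{e,f\in E_n}$, a real $n\times n$ matrix $C=(c_{ij})$ and a tour $\tau$ put $$Q[\tau]=\sum_{(e,f)\in\tau\times\tau}q_{ef},\qquad C(\tau)=\sum_{(i,j)\in\tau}c_{ij}.$$ The matrix $C$ is a \emph{linearization} of $Q$ if $Q[\tau]=C(\tau)$ for all $\tau\in\mathcal T_n$, and $Q$ is \emph{linearizable} if it has a linearization. The QTSP linearization problem (given $n$ and $Q$, decide whether $Q$ is linearizable) can be solved in $O(n^5)$ time, and a linearization of $Q$ can be constructed in $O(n^5)$ time whenever one exists. More precisely, there is a single program for a real RAM (unit cost for each exact arithmetic operation $+,-,\times,/$ and each comparison on real numbers, each access to a cell of an array, and each elementary operation on integers) that, for every $n$ and every $Q$, halts after $O(n^5)$ elementary operations, with a constant that does not depend on $n$ or $Q$, answers correctly whether $Q$ is linearizable, and, if it is, outputs a linearization of $Q$. -/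

import Mathlib

open scoped Asymptotics

/-! ## The quadratic travelling salesman problem on the complete digraph -/

namespace QTSP

/-- Arcs of the complete directed graph on `Fin n` (no loops). -/
abbrev Arc (n : ℕ) : Type := {e : Fin n × Fin n // e.1 ≠ e.2}

/-- A tour, i.e. a directed Hamiltonian cycle of the complete digraph on `Fin n`, given by its
successor permutation: a single cycle that moves every node. -/
structure Tour (n : ℕ) where
  succ : Equiv.Perm (Fin n)
  isCycle : succ.IsCycle
  succ_ne : ∀ i, succ i ≠ i

/-- The arc by which the tour leaves the node `i`. The arcs of the tour are `τ.arc i`, one for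
each node `i`. -/
def Tour.arc {n : ℕ} (τ : Tour n) (i : Fin n) : Arc n :=
  ⟨(i, τ.succ i), (τ.succ_ne i).symm⟩

/-- The quadratic cost `Q[τ]`: the sum of `Q e f` over all ordered pairs `(e, f)` of arcs of the
tour, the pairs `(e, e)` included. -/
def quadCost {n : ℕ} (Q : Matrix (Arc n) (Arc n) ℝ) (τ : Tour n) : ℝ :=
  ∑ i, ∑ k, Q (τ.arc i) (τ.arc k)

/-- The linear cost `C(τ)`: the sum of `C i j` over the arcs `(i, j)` of the tour. -/
def linCost {n : ℕ} (C : Matrix (Fin n) (Fin n) ℝ) (τ : Tour n) : ℝ :=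
  ∑ i, C i (τ.succ i)

/-- `C` is a linearization of `Q`. -/
def IsLinearization {n : ℕ} (C : Matrix (Fin n) (Fin n) ℝ) (Q : Matrix (Arc n) (Arc n) ℝ) :
    Prop :=
  ∀ τ : Tour n, quadCost Q τ = linCost C τ

/-- `Q` is (tour-)linearizable. -/
def Linearizable {n : ℕ} (Q : Matrix (Arc n) (Arc n) ℝ) : Prop :=
  ∃ C : Matrix (Fin n) (Fin n) ℝ, IsLinearization C Q

end QTSP

/-! ## A real RAM

A random access machine with integer and real storage, programmed in a structured imperative
language. A program is a fixed finite object: it does not depend on the input. Control flow,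
array indices and integer storage use integers only; a real number can influence them only through
comparisons, so there is no rounding of reals. The only constants in programs are integers.
Integers can only be copied, incremented and decremented, so within `t` steps no integer exceeds
by more than `t` the maximum of the initial integers and the constants of the program. -/

namespace RealRAM

/-- Contents of the storage: integer variables, real variables, integer arrays and real arrays.
Arrays have four indices; arrays with fewer indices use the index `0` in the others. -/
@[ext] structure State where
  ivar : ℕ → ℕ
  rvar : ℕ → ℝ
  iarr : ℕ → ℕ → ℕ → ℕ → ℕ → ℕ
  rarr : ℕ → ℕ → ℕ → ℕ → ℕ → ℝ

/-- Integer expressions. -/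
inductive IExpr : Type
  | lit (c : ℕ)
  | var (x : ℕ)
  | get (a : ℕ) (i j k l : IExpr)
  | succ (e : IExpr)
  | pred (e : IExpr)

/-- Real expressions. -/
inductive RExpr : Type
  | lit (c : ℤ)
  | cast (e : IExpr)
  | var (x : ℕ)
  | get (a : ℕ) (i j k l : IExpr)
  | add (e f : RExpr)
  | sub (e f : RExpr)
  | mul (e f : RExpr)
  | div (e f : RExpr)

/-- Tests. -/
inductive Test : Type
  | ieq (e f : IExpr)
  | ilt (e f : IExpr)
  | req (e f : RExpr)
  | rlt (e f : RExpr)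
  | neg (b : Test)
  | conj (b c : Test)

/-- Programs. -/
inductive Program : Type
  | skip
  | isetVar (x : ℕ) (e : IExpr)
  | rsetVar (x : ℕ) (e : RExpr)
  | isetArr (a : ℕ) (i j k l : IExpr) (e : IExpr)
  | rsetArr (a : ℕ) (i j k l : IExpr) (e : RExpr)
  | seq (p q : Program)
  | ite (b : Test) (p q : Program)
  | while (b : Test) (p : Program)

/-- Value of an integer expression; the predecessor of `0` is `0`. -/
def IExpr.eval (s : State) : IExpr → ℕ
  | lit c => c
  | var x => s.ivar x
  | get a i j k l => s.iarr a (i.eval s) (j.eval s) (k.eval s) (l.eval s)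
  | succ e => e.eval s + 1
  | pred e => e.eval s - 1

/-- Number of elementary operations of an integer expression. -/
def IExpr.cost : IExpr → ℕ
  | lit _ => 1
  | var _ => 1
  | get _ i j k l => i.cost + j.cost + k.cost + l.cost + 1
  | succ e => e.cost + 1
  | pred e => e.cost + 1

/-- Value of a real expression, with exact arithmetic; a division by `0` returns `0`. -/
noncomputable def RExpr.eval (s : State) : RExpr → ℝ
  | lit c => (c : ℝ)
  | cast e => (e.eval s : ℝ)
  | var x => s.rvar x
  | get a i j k l => s.rarr a (i.eval s) (j.eval s) (k.eval s) (l.eval s)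
  | add e f => e.eval s + f.eval s
  | sub e f => e.eval s - f.eval s
  | mul e f => e.eval s * f.eval s
  | div e f => e.eval s / f.eval s

/-- Number of elementary operations of a real expression. -/
def RExpr.cost : RExpr → ℕ
  | lit _ => 1
  | cast e => e.cost + 1
  | var _ => 1
  | get _ i j k l => i.cost + j.cost + k.cost + l.cost + 1
  | add e f => e.cost + f.cost + 1
  | sub e f => e.cost + f.cost + 1
  | mul e f => e.cost + f.cost + 1
  | div e f => e.cost + f.cost + 1

/-- The test `b` succeeds in the state `s`. -/
def Test.holds (s : State) : Test → Prop
  | ieq e f => e.eval s = f.eval s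
  | ilt e f => e.eval s < f.eval s
  | req e f => e.eval s = f.eval s
  | rlt e f => e.eval s < f.eval s
  | neg b => ¬ b.holds s
  | conj b c => b.holds s ∧ c.holds s

/-- Number of elementary operations of a test. -/
def Test.cost : Test → ℕ
  | ieq e f => e.cost + f.cost + 1
  | ilt e f => e.cost + f.cost + 1
  | req e f => e.cost + f.cost + 1
  | rlt e f => e.cost + f.cost + 1
  | neg b => b.cost + 1
  | conj b c => b.cost + c.cost + 1

/-- `g` with the value at the index quadruple `(i, j, k, l)` of the array `a` replaced by `v`. -/
def setAt {α : Type} (g : ℕ → ℕ → ℕ → ℕ → ℕ → α) (a i j k l : ℕ) (v : α) :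
    ℕ → ℕ → ℕ → ℕ → ℕ → α :=
  fun a' i' j' k' l' =>
    if a' = a ∧ i' = i ∧ j' = j ∧ k' = k ∧ l' = l then v else g a' i' j' k' l'

/-- `Run p s t s'`: started in the state `s`, the program `p` halts in the state `s'` after exactly
`t` elementary operations. -/
inductive Run : Program → State → ℕ → State → Prop
  | skip (s : State) : Run .skip s 1 s
  | isetVar (s : State) (x : ℕ) (e : IExpr) :
      Run (.isetVar x e) s (e.cost + 1)
        { s with ivar := Function.update s.ivar x (e.eval s) }
  | rsetVar (s : State) (x : ℕ) (e : RExpr) :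
      Run (.rsetVar x e) s (e.cost + 1)
        { s with rvar := Function.update s.rvar x (e.eval s) }
  | isetArr (s : State) (a : ℕ) (i j k l : IExpr) (e : IExpr) :
      Run (.isetArr a i j k l e) s (i.cost + j.cost + k.cost + l.cost + e.cost + 1)
        { s with
          iarr := setAt s.iarr a (i.eval s) (j.eval s) (k.eval s) (l.eval s) (e.eval s) }
  | rsetArr (s : State) (a : ℕ) (i j k l : IExpr) (e : RExpr) :
      Run (.rsetArr a i j k l e) s (i.cost + j.cost + k.cost + l.cost + e.cost + 1)
        { s with
          rarr := setAt s.rarr a (i.eval s) (j.eval s) (k.eval s) (l.eval s) (e.eval s) }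
  | seq {p q : Program} {s s' s'' : State} {t t' : ℕ} :
      Run p s t s' → Run q s' t' s'' → Run (.seq p q) s (t + t') s''
  | ite_true {b : Test} {p q : Program} {s s' : State} {t : ℕ} :
      b.holds s → Run p s t s' → Run (.ite b p q) s (b.cost + t) s'
  | ite_false {b : Test} {p q : Program} {s s' : State} {t : ℕ} :
      ¬ b.holds s → Run q s t s' → Run (.ite b p q) s (b.cost + t) s'
  | while_true {b : Test} {p : Program} {s s' s'' : State} {t t' : ℕ} :
      b.holds s → Run p s t s' → Run (.while b p) s' t' s'' →
      Run (.while b p) s (b.cost + t + t') s''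
  | while_false {b : Test} {p : Program} {s : State} :
      ¬ b.holds s → Run (.while b p) s b.cost s

/-- The machine is deterministic: the running time and the final state are determined by the
program and the initial state. -/
theorem Run.deterministic {p : Program} {s s₁ s₂ : State} {t₁ t₂ : ℕ}
    (h₁ : Run p s t₁ s₁) (h₂ : Run p s t₂ s₂) : t₁ = t₂ ∧ s₁ = s₂ := by
  induction h₁ generalizing t₂ s₂ with
  | seq _ _ ih ih' =>
    cases h₂ with
    | seq a b =>
      obtain ⟨rfl, rfl⟩ := ih a
      obtain ⟨rfl, rfl⟩ := ih' b
      exact ⟨rfl, rfl⟩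
  | ite_true hb _ ih =>
    cases h₂ with
    | ite_true _ a => obtain ⟨rfl, rfl⟩ := ih a; exact ⟨rfl, rfl⟩
    | ite_false hb' _ => exact absurd hb hb'
  | ite_false hb _ ih =>
    cases h₂ with
    | ite_true hb' _ => exact absurd hb' hb
    | ite_false _ a => obtain ⟨rfl, rfl⟩ := ih a; exact ⟨rfl, rfl⟩
  | while_true hb _ _ ih ih' =>
    cases h₂ with
    | while_true _ a b =>
      obtain ⟨rfl, rfl⟩ := ih a
      obtain ⟨rfl, rfl⟩ := ih' b
      exact ⟨rfl, rfl⟩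
    | while_false hb' => exact absurd hb hb'
  | while_false hb =>
    cases h₂ with
    | while_true hb' _ _ => exact absurd hb' hb
    | while_false _ => exact ⟨rfl, rfl⟩
  | _ => cases h₂; exact ⟨rfl, rfl⟩

end RealRAM

/-! ## Input and output conventions for the linearization problem -/

namespace QTSP

/-- Initial storage: the integer variable `0` holds `n`, the cell `[i, j, k, l]` of the real array
`0` holds the entry of `Q` at the arcs `(i, j)` and `(k, l)` (nodes are numbered from `0`), and
everything else is `0`. -/
noncomputable def input (n : ℕ) (Q : Matrix (Arc n) (Arc n) ℝ) : RealRAM.State where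
  ivar x := if x = 0 then n else 0
  rvar _ := 0
  iarr _ _ _ _ _ := 0
  rarr a i j k l :=
    if h : a = 0 ∧ (i < n ∧ j < n ∧ i ≠ j) ∧ (k < n ∧ l < n ∧ k ≠ l) then
      Q ⟨(⟨i, h.2.1.1⟩, ⟨j, h.2.1.2.1⟩), fun e => h.2.1.2.2 (congrArg Fin.val e)⟩
        ⟨(⟨k, h.2.2.1⟩, ⟨l, h.2.2.2.1⟩), fun e => h.2.2.2.2 (congrArg Fin.val e)⟩
    else 0

/-- The answer of the machine, in the integer variable `1`: `1` stands for yes, `0` for no. -/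
def answer (s : RealRAM.State) : ℕ := s.ivar 1

/-- The `n × n` matrix written by the machine, in the cells `[i, j, 0, 0]` of the real array
`1`. -/
def output (n : ℕ) (s : RealRAM.State) : Matrix (Fin n) (Fin n) ℝ :=
  fun i j => s.rarr 1 i j 0 0

end QTSP

/-! Let `z` be the last node, `S` the set of the other nodes and m its size. Every tour of `S ∪ {z}`
arises from a tour σ of `S` by replacing an arc (i, j) with (i, z), (z, j). By bilinearity the
quadratic cost becomes Q(σ) + L_ij(σ) + K_ij, with L_ij (`insLin`) linear in σ and K_ij (`insConst`)
constant. A linearization can be normalized to vanish on the arcs at `z`, so the condition is Q(σ) +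
L_ij(σ) + K_ij = c(σ) − c_ij for all σ and all arcs (i, j) of σ (`linearizesOn_insert`).

Summation over the arcs of σ gives (m − 2) Q(σ) + T(σ) = (m − 1) c(σ), where T (`insTotal`) is
linear (`sum_insertions`). First, this forces c_ij = (T(σ) − Q(σ)) / (m − 1) − L_ij(σ) − K_ij for
any tour σ through (i, j). One tour per arc thus yields the only possible normalized costs, and they
work whenever a linearization exists (`linearizesOn_of_candidate`). Second, Q(σ) can be eliminated
if m > 2: for each arc (i, j), a linear function must take a prescribed value on all tours of `S`
through (i, j) (`linearizesOn_insert_iff_residual`). If m > 3, contracting (i, j) and averaging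
again reduces this to one equation for each arc (k, l) disjoint from (i, j)
(`forall_tours_through_iff`).

The program tabulates T, computes the candidate costs and tests these equations. If m is 2 or 3 the
candidate always works, and at most two nodes are treated directly. Running time is bounded through
the nesting depth of the loops. -/

/-! ## Tours of a finite set of nodes -/

namespace QTSP

open Equiv Finset

variable {α : Type*}

/-- The permutation `σ` fixes all points outside `S` and permutes `S` cyclically. A singleton has
one tour, the identity. -/
structure IsTourOn (σ : Perm α) (S : Finset α) : Prop where
  fix : ∀ a, a ∉ S → σ a = a
  reach : ∀ a ∈ S, ∀ b ∈ S, ∃ k : ℕ, (σ ^ k) a = b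

theorem reach_trans {σ : Perm α} {a b c : α} (hab : ∃ k : ℕ, (σ ^ k) a = b)
    (hbc : ∃ k : ℕ, (σ ^ k) b = c) : ∃ k : ℕ, (σ ^ k) a = c := by
  obtain ⟨k, rfl⟩ := hab
  obtain ⟨l, rfl⟩ := hbc
  exact ⟨l + k, by rw [pow_add, Perm.mul_apply]⟩

namespace IsTourOn

variable {σ : Perm α} {S : Finset α} {z i : α}

theorem mem (h : IsTourOn σ S) {a : α} (ha : a ∈ S) : σ a ∈ S := by
  by_contra hn
  have := σ.injective (h.fix _ hn)
  exact hn (this.symm ▸ ha)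

theorem symm_mem (h : IsTourOn σ S) {a : α} (ha : a ∈ S) : σ.symm a ∈ S := by
  by_contra hn
  have := h.fix _ hn
  rw [apply_symm_apply] at this
  exact hn (this ▸ ha)

theorem ne (h : IsTourOn σ S) (hS : 1 < S.card) {a : α} (ha : a ∈ S) : σ a ≠ a := by
  intro hf
  obtain ⟨b, hb, hba⟩ := exists_mem_ne hS a
  obtain ⟨k, hk⟩ := h.reach a ha b hb
  have : ∀ k : ℕ, (σ ^ k) a = a := by
    intro k
    induction k with
    | zero => rfl
    | succ k ih => rw [pow_succ, Perm.mul_apply, hf, ih]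
  exact hba (hk ▸ this k)

theorem sum_comp (h : IsTourOn σ S) (g : α → ℝ) : ∑ a ∈ S, g (σ a) = ∑ a ∈ S, g a :=
  sum_bij (fun a _ => σ a) (fun _ ha => h.mem ha) (fun _ _ _ _ e => σ.injective e)
    (fun b hb => ⟨σ.symm b, h.symm_mem hb, σ.apply_symm_apply b⟩) (fun _ _ => rfl)

/-- Relabelling of nodes; it will carry the tour `0, 1, …` to a tour through a prescribed arc. -/
theorem conj (h : IsTourOn σ S) {π : Perm α} (hπ : ∀ a, π a ∈ S ↔ a ∈ S) :
    IsTourOn (π * σ * π⁻¹) S := by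
  have hπ' : ∀ a, π⁻¹ a ∈ S ↔ a ∈ S := fun a => by rw [← hπ]; simp
  constructor
  · intro a ha
    rw [Perm.mul_apply, Perm.mul_apply, h.fix _ (fun e => ha ((hπ' a).1 e))]; simp
  · intro a ha b hb
    obtain ⟨k, hk⟩ := h.reach _ ((hπ' a).2 ha) _ ((hπ' b).2 hb)
    exact ⟨k, by rw [conj_pow, Perm.mul_apply, Perm.mul_apply, hk]; simp⟩

theorem singleton (a : α) : IsTourOn (1 : Perm α) {a} := by
  constructor
  · intro b _
    rfl
  · intro b hb c hc
    rw [mem_singleton] at hb hc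
    exact ⟨0, by rw [hb, hc]; rfl⟩

variable [DecidableEq α]

theorem mul_swap_left (h : IsTourOn σ S) (hz : z ∉ S) : (σ * swap i z) i = z := by
  simp [h.fix z hz]

theorem mul_swap_right : (σ * swap i z) z = σ i := by simp

theorem mul_swap_of_ne {a : α} (hi : a ≠ i) (hz : a ≠ z) : (σ * swap i z) a = σ a := by
  simp [swap_apply_of_ne_of_ne hi hz]

/-- The new node `z` can be inserted into a tour after the node `i`. -/
theorem insert (h : IsTourOn σ S) (hz : z ∉ S) (hi : i ∈ S) :
    IsTourOn (σ * swap i z) (insert z S) := by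
  have hstep : ∀ a ∈ S, ∃ k : ℕ, ((σ * swap i z) ^ k) a = σ a := by
    intro a ha
    by_cases hai : a = i
    · refine ⟨2, ?_⟩
      rw [pow_two, Perm.mul_apply, hai, h.mul_swap_left hz, mul_swap_right]
    · exact ⟨1, by rw [pow_one, mul_swap_of_ne (z := z) hai (fun e => hz (e ▸ ha))]⟩
  have hS : ∀ k : ℕ, ∀ a ∈ S, ∃ l : ℕ, ((σ * swap i z) ^ l) a = (σ ^ k) a := by
    intro k
    induction k with
    | zero => exact fun a _ => ⟨0, rfl⟩
    | succ k ih =>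
      intro a ha
      rw [pow_succ, Perm.mul_apply]
      exact reach_trans (hstep a ha) (ih _ (h.mem ha))
  have hSS : ∀ a ∈ S, ∀ b ∈ S, ∃ k : ℕ, ((σ * swap i z) ^ k) a = b := by
    intro a ha b hb
    obtain ⟨k, rfl⟩ := h.reach a ha b hb
    exact hS k a ha
  have hzS : ∀ b ∈ S, ∃ k : ℕ, ((σ * swap i z) ^ k) z = b := fun b hb =>
    reach_trans ⟨1, by rw [pow_one, mul_swap_right]⟩ (hSS _ (h.mem hi) b hb)
  have hSz : ∀ a ∈ S, ∃ k : ℕ, ((σ * swap i z) ^ k) a = z := fun a ha =>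
    reach_trans (hSS a ha i hi) ⟨1, by rw [pow_one, h.mul_swap_left hz]⟩
  constructor
  · intro a ha
    rw [mem_insert, not_or] at ha
    rw [mul_swap_of_ne (i := i) (ne_of_mem_of_not_mem hi ha.2).symm ha.1, h.fix a ha.2]
  · intro a ha b hb
    rw [mem_insert] at ha hb
    rcases ha with ha | ha <;> rcases hb with hb | hb
    · exact ⟨0, by rw [ha, hb]; rfl⟩
    · exact ha ▸ hzS b hb
    · exact hb ▸ hSz a ha
    · exact hSS a ha b hb

/-- Insertion of a node replaces one arc by two. -/
theorem sum_insert (h : IsTourOn σ S) (hz : z ∉ S) (hi : i ∈ S) (g : α → α → ℝ) :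
    ∑ a ∈ Insert.insert z S, g a ((σ * swap i z) a) =
      ∑ a ∈ S, g a (σ a) + (g i z + g z (σ i) - g i (σ i)) := by
  rw [Finset.sum_insert hz, ← add_sum_erase S _ hi, ← add_sum_erase S (fun a => g a (σ a)) hi,
    h.mul_swap_left hz, mul_swap_right]
  have : ∀ a ∈ S.erase i, g a ((σ * swap i z) a) = g a (σ a) := fun a ha => by
    rw [mul_swap_of_ne (z := z) (mem_erase.1 ha).1 (fun e => hz (e ▸ (mem_erase.1 ha).2))]
  rw [sum_congr rfl this]
  ring

/-- Every tour arises by the insertion of a given node. -/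
theorem exists_insert {τ : Perm α} (h : IsTourOn τ (Insert.insert z S)) (hz : z ∉ S)
    (hS : S.Nonempty) : ∃ σ i, IsTourOn σ S ∧ i ∈ S ∧ τ = σ * swap i z := by
  have hcard : 1 < (Insert.insert z S).card := by
    rw [card_insert_of_notMem hz]
    exact Nat.succ_lt_succ hS.card_pos
  have hzi : τ z ≠ z := h.ne hcard (mem_insert_self z S)
  obtain ⟨i, hi⟩ : ∃ i, τ i = z := ⟨τ.symm z, τ.apply_symm_apply z⟩
  have hiz : i ≠ z := fun e => hzi (e ▸ hi)
  have hiS : i ∈ S := by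
    have := h.symm_mem (mem_insert_self z S)
    rw [τ.symm_apply_eq.2 hi.symm] at this
    exact (mem_insert.1 this).resolve_left hiz
  have hz' : (τ * swap i z) z = z := by simp [hi]
  have hi' : (τ * swap i z) i = τ z := by simp
  refine ⟨τ * swap i z, i, ⟨?_, ?_⟩, hiS, by rw [mul_assoc, swap_mul_self, mul_one]⟩
  · intro a ha
    by_cases haz : a = z
    · rw [haz, hz']
    · rw [mul_swap_of_ne (i := i) (ne_of_mem_of_not_mem hiS ha).symm haz]
      exact h.fix a (by simp [haz, ha])
  -- A walk of `τ` is shortened by skipping `z`: at `i` the two steps through `z` become one, hence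
  -- strong induction on the length.
  · have key : ∀ k : ℕ, ∀ a ∈ S, (τ ^ k) a ∈ S → ∃ l : ℕ, ((τ * swap i z) ^ l) a = (τ ^ k) a := by
      intro k
      induction k using Nat.strong_induction_on with
      | _ k ih =>
        intro a ha hb
        match k, ih, hb with
        | 0, _, _ => exact ⟨0, rfl⟩
        | k + 1, ih, hb =>
          by_cases hai : a = i
          · subst hai
            match k, ih, hb with
            | 0, _, hb =>
              rw [zero_add, pow_one, hi] at hb
              exact absurd hb hz
            | k + 1, ih, hb =>
              rw [pow_succ, pow_succ, Perm.mul_apply, Perm.mul_apply, hi] at hb ⊢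
              refine reach_trans ⟨1, by rw [pow_one, hi']⟩ (ih k (by omega) _ ?_ hb)
              exact (mem_insert.1 (h.mem (mem_insert_self z S))).resolve_left hzi
          · have haz : a ≠ z := fun e => hz (e ▸ ha)
            rw [pow_succ, Perm.mul_apply] at hb ⊢
            refine reach_trans ⟨1, by rw [pow_one, mul_swap_of_ne hai haz]⟩
              (ih k (by omega) _ ?_ hb)
            refine (mem_insert.1 (h.mem (mem_insert_of_mem ha))).resolve_left fun e => hai ?_
            exact τ.injective (e.trans hi.symm)
    intro a ha b hb
    obtain ⟨k, hk⟩ := h.reach a (mem_insert_of_mem ha) b (mem_insert_of_mem hb)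
    obtain ⟨l, hl⟩ := key k a ha (hk ▸ hb)
    exact ⟨l, hl.trans hk⟩

end IsTourOn

/-! ### Existence and uniqueness of tours through an arc. -/

variable [DecidableEq α]

/-- Every arc between two distinct nodes of `S` lies on a tour of `S`. -/
theorem exists_isTourOn {S : Finset α} {k l : α} (hk : k ∈ S) (hl : l ∈ S) (hkl : k ≠ l) :
    ∃ σ : Perm α, IsTourOn σ S ∧ σ k = l := by
  have aux : ∀ S : Finset α, S.Nonempty → ∃ σ : Perm α, IsTourOn σ S := by
    intro S hS
    induction hS using Finset.Nonempty.cons_induction with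
    | singleton a => exact ⟨1, IsTourOn.singleton a⟩
    | cons a s ha hs ih =>
      obtain ⟨σ, hσ⟩ := ih
      obtain ⟨i, hi⟩ := hs
      exact ⟨_, cons_eq_insert a s ha ▸ hσ.insert ha hi⟩
  -- The node `l` is removed and inserted again directly after `k`.
  have hk' : k ∈ S.erase l := mem_erase.2 ⟨hkl, hk⟩
  obtain ⟨σ, hσ⟩ := aux (S.erase l) ⟨k, hk'⟩
  have := hσ.insert (notMem_erase l S) hk'
  rw [insert_erase hl] at this
  exact ⟨_, this, hσ.mul_swap_left (notMem_erase l S)⟩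

/-- The tour `0, 1, …, m` of the numbers up to `m`. -/
theorem exists_isTourOn_range (m : ℕ) : ∃ ρ : Perm ℕ, IsTourOn ρ (range (m + 1)) ∧
    (∀ t < m, ρ t = t + 1) ∧ ρ m = 0 := by
  induction m with
  | zero => exact ⟨1, IsTourOn.singleton 0, by simp, rfl⟩
  | succ m ih =>
    obtain ⟨ρ, hρ, h1, h2⟩ := ih
    have hm : m ∈ range (m + 1) := by simp
    refine ⟨_, range_add_one (n := m + 1) ▸ hρ.insert notMem_range_self hm, ?_, ?_⟩
    · intro t ht
      by_cases htm : t = m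
      · subst htm
        exact hρ.mul_swap_left notMem_range_self
      · rw [IsTourOn.mul_swap_of_ne htm (by omega), h1 t (by omega)]
    · rw [IsTourOn.mul_swap_right, h2]

/-- In a set of at most three nodes an arc lies on one tour only. -/
theorem IsTourOn.eqOn_of_card_le_three {σ σ' : Perm α} {S : Finset α} (h : IsTourOn σ S)
    (h' : IsTourOn σ' S) (h1 : 1 < S.card) (h3 : S.card ≤ 3) {i : α} (hi : i ∈ S)
    (he : σ i = σ' i) : ∀ a ∈ S, σ a = σ' a := by
  -- A third node cannot be followed by itself, nor by `σ i`, whose predecessor is `i`; only `i` is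
  -- left.
  have key : ∀ a ∈ S, a ≠ i → a ≠ σ i → σ a = i ∧ σ' a = i := by
    intro a ha hai haj
    have hsub : ∀ b ∈ S, b = i ∨ b = σ i ∨ b = a := by
      by_contra! hb
      obtain ⟨b, hb, h1, h2, h3⟩ := hb
      have : ({i, σ i, a, b} : Finset α).card = 4 := by
        rw [card_insert_of_notMem, card_insert_of_notMem, card_insert_of_notMem, card_singleton]
        · simpa using h3.symm
        · simpa using ⟨haj.symm, h2.symm⟩
        · simpa using ⟨(h.ne ‹_› hi).symm, hai.symm, h1.symm⟩
      have hle := card_le_card (s := {i, σ i, a, b}) (t := S) (by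
        intro x hx
        simp only [mem_insert, mem_singleton] at hx
        rcases hx with rfl | rfl | rfl | rfl
        exacts [hi, h.mem hi, ha, hb])
      omega
    constructor
    · rcases hsub _ (h.mem ha) with e | e | e
      · exact e
      · exact absurd (σ.injective e) hai
      · exact absurd e (h.ne h1 ha)
    · rcases hsub _ (h'.mem ha) with e | e | e
      · exact e
      · exact absurd (σ'.injective (e.trans he)) hai
      · exact absurd e (h'.ne h1 ha)
  intro a ha
  by_cases hai : a = i
  · rw [hai, he]
  by_cases haj : a = σ i
  · by_contra hne
    have hj : σ i ∈ S := h.mem hi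
    subst haj
    have hb : ∀ b ∈ S, b ≠ i → b ≠ σ i → False := by
      intro b hb hbi hbj
      obtain ⟨e1, e2⟩ := key b hb hbi hbj
      have c1 : σ (σ i) ≠ i := fun e => hbj (σ.injective (e1.trans e.symm))
      have c2 : σ' (σ i) ≠ i := fun e => hbj (σ'.injective (e2.trans e.symm))
      have hd : σ (σ i) ≠ σ i := h.ne h1 hj
      have hd' : σ' (σ i) ≠ σ i := h'.ne h1 hj
      have k1 := (key _ (h.mem hj) c1 hd).2
      have k2 := (key _ (h'.mem hj) c2 hd').2
      exact hne (σ'.injective (k1.trans k2.symm))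
    refine hne ?_
    have c1 : σ (σ i) = i := by
      by_contra e
      exact hb _ (h.mem hj) e (h.ne h1 hj)
    have c2 : σ' (σ i) = i := by
      by_contra e
      exact hb _ (h'.mem hj) e (h'.ne h1 hj)
    rw [c1, c2]
  · obtain ⟨e1, e2⟩ := key a ha hai haj
    rw [e1, e2]

end QTSP

/-! ## Quadratic costs of tours and insertion of nodes -/

namespace QTSP

open Equiv Finset

section Costs

variable {α : Type*}

/-- The linear cost of a tour of `S`. -/
def linOn (c : α → α → ℝ) (σ : Perm α) (S : Finset α) : ℝ :=
  ∑ a ∈ S, c a (σ a)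

/-- The quadratic cost of a tour of `S`. -/
def quadOn (q : α → α → α → α → ℝ) (σ : Perm α) (S : Finset α) : ℝ :=
  ∑ a ∈ S, ∑ b ∈ S, q a (σ a) b (σ b)

/-- The linear costs `c` agree with the quadratic costs `q` on all tours of `S`. -/
def LinearizesOn (c : α → α → ℝ) (q : α → α → α → α → ℝ) (S : Finset α) : Prop :=
  ∀ τ : Perm α, IsTourOn τ S → quadOn q τ S = linOn c τ S

/-- The symmetrized quadratic cost. -/
def sq (q : α → α → α → α → ℝ) (a b c d : α) : ℝ :=
  q a b c d + q c d a b

/-- The cost of the arc `(a, b)` against the change made by the insertion of `z` into `(i, j)`. -/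
def insLin (q : α → α → α → α → ℝ) (z i j a b : α) : ℝ :=
  sq q i z a b + sq q z j a b - sq q i j a b

/-- The quadratic cost of the change made by the insertion of `z` into `(i, j)`. -/
def insConst (q : α → α → α → α → ℝ) (z i j : α) : ℝ :=
  q i j i j + q i z i z + q z j z j + sq q i z z j - sq q i j i z - sq q i j z j

/-- The contribution of the arc `(a, b)` to the sum of all costs of insertions of `z`. -/
noncomputable def insTotal (q : α → α → α → α → ℝ) (z : α) (S : Finset α) (a b : α) : ℝ :=
  insConst q z a b + ∑ t ∈ S, (sq q t z a b + sq q z t a b)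

/-- The cost of the arc `(i, j)` extracted from a tour `σ` through it. -/
noncomputable def candidate (q : α → α → α → α → ℝ) (z : α) (S : Finset α) (σ : Perm α)
    (i j : α) : ℝ :=
  (linOn (insTotal q z S) σ S - quadOn q σ S) / (S.card - 1) - linOn (insLin q z i j) σ S -
    insConst q z i j

/-- The linear function that has to be constant on the tours of `S` through `(i, j)`. -/
noncomputable def residual (q : α → α → α → α → ℝ) (c : α → α → ℝ) (z : α) (S : Finset α)
    (i j a b : α) : ℝ :=
  (S.card - 2) * insLin q z i j a b - insTotal q z S a b + c a b

/-! ### Averaging over insertions and the linear conditions that result. -/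

variable {σ : Perm α} {S : Finset α} {q : α → α → α → α → ℝ} {c : α → α → ℝ} {z i j : α}

/-- The factor `S.card - 2`: each insertion contributes the old cost once, and the terms of the
removed arcs add up to minus twice that cost. The other terms are linear in `σ` after reindexing
successors as nodes. -/
theorem sum_insertions (h : IsTourOn σ S) :
    ∑ i ∈ S, (quadOn q σ S + linOn (insLin q z i (σ i)) σ S + insConst q z i (σ i)) =
      (S.card - 2) * quadOn q σ S + linOn (insTotal q z S) σ S := by
  have h1 : ∑ i ∈ S, linOn (insLin q z i (σ i)) σ S =
      ∑ b ∈ S, ∑ t ∈ S, (sq q t z b (σ b) + sq q z t b (σ b)) - 2 * quadOn q σ S := by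
    simp only [linOn, insLin]
    rw [sum_comm]
    simp only [sum_sub_distrib, sum_add_distrib]
    have h2 : ∀ b, ∑ i ∈ S, sq q z (σ i) b (σ b) = ∑ i ∈ S, sq q z i b (σ b) :=
      fun b => h.sum_comp fun i => sq q z i b (σ b)
    have h3 : ∑ b ∈ S, ∑ i ∈ S, sq q i (σ i) b (σ b) = 2 * quadOn q σ S := by
      simp only [sq, sum_add_distrib, quadOn]
      rw [sum_comm, two_mul]
    simp only [h2, h3]
  rw [sum_add_distrib, sum_add_distrib, h1, sum_const, nsmul_eq_mul]
  simp only [linOn, insTotal, sum_add_distrib]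
  ring

variable [DecidableEq α]

theorem linOn_insert (h : IsTourOn σ S) (hz : z ∉ S) (hi : i ∈ S) :
    linOn c (σ * swap i z) (insert z S) =
      linOn c σ S + (c i z + c z (σ i) - c i (σ i)) :=
  h.sum_insert hz hi c

/-- Polarization: with u = (i, z) + (z, j) − (i, j) as a formal sum of arcs, `insLin` is the
symmetrized form at u and an arc of `σ`, and `insConst` is the quadratic form at u. -/
theorem quadOn_insert (h : IsTourOn σ S) (hz : z ∉ S) (hi : i ∈ S) :
    quadOn q (σ * swap i z) (insert z S) =
      quadOn q σ S + linOn (insLin q z i (σ i)) σ S + insConst q z i (σ i) := by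
  unfold quadOn
  rw [h.sum_insert hz hi fun a b => ∑ x ∈ insert z S, q a b x ((σ * swap i z) x)]
  simp only [fun a b => h.sum_insert hz hi (q a b)]
  simp only [linOn, insLin, insConst, sq, sum_add_distrib, sum_sub_distrib]
  ring

theorem linearizesOn_insert (hz : z ∉ S) (hS : S.Nonempty) (h1 : ∀ a ∈ S, c a z = 0)
    (h2 : ∀ b ∈ S, c z b = 0) :
    LinearizesOn c q (insert z S) ↔ ∀ σ : Perm α, IsTourOn σ S → ∀ i ∈ S,
      quadOn q σ S + linOn (insLin q z i (σ i)) σ S + insConst q z i (σ i) =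
        linOn c σ S - c i (σ i) := by
  constructor
  · intro h σ hσ i hi
    have := h _ (hσ.insert hz hi)
    rw [quadOn_insert hσ hz hi, linOn_insert hσ hz hi, h1 i hi, h2 _ (hσ.mem hi)] at this
    rw [this]
    ring
  · intro h τ hτ
    obtain ⟨σ, i, hσ, hi, rfl⟩ := hτ.exists_insert hz hS
    rw [quadOn_insert hσ hz hi, linOn_insert hσ hz hi, h1 i hi, h2 _ (hσ.mem hi), h σ hσ i hi]
    ring

/-- The linear costs linearize the quadratic ones if and only if, for each arc, a linear function
is constant on the tours through this arc. -/
theorem linearizesOn_insert_iff_residual (hz : z ∉ S) (hS : 2 < S.card) (h1 : ∀ a ∈ S, c a z = 0)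
    (h2 : ∀ b ∈ S, c z b = 0) :
    LinearizesOn c q (insert z S) ↔ ∀ i ∈ S, ∀ j ∈ S, i ≠ j → ∀ σ : Perm α, IsTourOn σ S →
      σ i = j → linOn (residual q c z S i j) σ S +
        (S.card - 2) * (insConst q z i j + c i j) = 0 := by
  have hm : (0 : ℝ) < S.card - 2 := by
    have : (2 : ℝ) < S.card := by exact_mod_cast hS
    linarith
  have hres : ∀ (σ : Perm α) (i j : α), linOn (residual q c z S i j) σ S =
      (S.card - 2) * linOn (insLin q z i j) σ S - linOn (insTotal q z S) σ S + linOn c σ S := by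
    intro σ i j
    simp only [linOn, residual, sum_add_distrib, sum_sub_distrib, mul_sum]
  rw [linearizesOn_insert hz (card_pos.1 (by omega)) h1 h2]
  constructor
  · rintro h i hi j _ _ σ hσ rfl
    -- The summed insertion equations express the quadratic cost of `σ` by linear ones, which
    -- removes it from the single equation.
    have hsum := sum_insertions (q := q) (z := z) hσ
    rw [sum_congr rfl (h σ hσ), sum_sub_distrib, sum_const, nsmul_eq_mul] at hsum
    change _ - linOn c σ S = _ at hsum
    rw [hres]
    have := h σ hσ i hi
    linear_combination (S.card - 2 : ℝ) * this + hsum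
  · intro h σ hσ i hi
    have hd : ∀ i ∈ S, (S.card - 2) * (linOn (insLin q z i (σ i)) σ S + insConst q z i (σ i)) =
        linOn (insTotal q z S) σ S - linOn c σ S - (S.card - 2) * c i (σ i) := by
      intro i hi
      have := h i hi _ (hσ.mem hi) (hσ.ne (by omega) hi).symm σ hσ rfl
      rw [hres] at this
      linear_combination this
    have hsum := sum_insertions (q := q) (z := z) hσ
    simp only [add_assoc, sum_add_distrib, sum_const, nsmul_eq_mul] at hsum
    rw [← sum_add_distrib] at hsum
    have hd' := sum_congr rfl hd
    rw [← mul_sum, sum_sub_distrib, sum_const, nsmul_eq_mul, ← mul_sum] at hd'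
    change _ = _ - _ * linOn c σ S at hd'
    -- Conversely, the sum of the linear conditions over the arcs of `σ`, compared with
    -- `sum_insertions`, recovers the quadratic cost; both sides appear doubled.
    have hQ : (S.card - 2) * quadOn q σ S =
        (S.card - 1) * linOn c σ S - linOn (insTotal q z S) σ S := by
      have : (2 : ℝ) * ((S.card - 2) * quadOn q σ S) =
          2 * ((S.card - 1) * linOn c σ S - linOn (insTotal q z S) σ S) := by
        linear_combination (S.card - 2 : ℝ) * hsum - hd'
      linarith
    refine mul_left_cancel₀ hm.ne' ?_
    linear_combination hQ + hd i hi

/-- If there is a linearization, then the extracted costs are one. -/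
theorem linearizesOn_of_candidate {C : α → α → ℝ} (hz : z ∉ S) (hS : 1 < S.card)
    (h1 : ∀ a ∈ S, c a z = 0) (h2 : ∀ b ∈ S, c z b = 0)
    (hc : ∀ i ∈ S, ∀ j ∈ S, i ≠ j → ∃ σ : Perm α, IsTourOn σ S ∧ σ i = j ∧
      c i j = candidate q z S σ i j)
    (hC : LinearizesOn C q (insert z S)) : LinearizesOn c q (insert z S) := by
  have hm : (0 : ℝ) < S.card - 1 := by
    have : (1 : ℝ) < S.card := by exact_mod_cast hS
    linarith
  have hf : ∀ σ : Perm α, IsTourOn σ S → ∀ i ∈ S,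
      quadOn q σ S + linOn (insLin q z i (σ i)) σ S + insConst q z i (σ i) =
        linOn C σ S + (C i z + C z (σ i) - C i (σ i)) := fun σ hσ i hi => by
    rw [← quadOn_insert hσ hz hi, ← linOn_insert hσ hz hi]
    exact hC _ (hσ.insert hz hi)
  have hsum : ∀ σ : Perm α, IsTourOn σ S →
      (S.card - 2) * quadOn q σ S + linOn (insTotal q z S) σ S =
        (S.card - 1) * linOn C σ S + ∑ t ∈ S, (C t z + C z t) := fun σ hσ => by
    rw [← sum_insertions hσ, sum_congr rfl (hf σ hσ), sum_add_distrib, sum_sub_distrib,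
      sum_add_distrib, hσ.sum_comp fun t => C z t, sum_const, nsmul_eq_mul, sum_add_distrib]
    change _ + (_ - linOn C σ S) = _
    ring
  -- The candidate is the normalized form of `C`: the costs at `z` are moved to the other arcs, and
  -- the compensating constant is divided by the number `S.card - 1` of arcs of a tour that avoid
  -- `z`.
  have hc' : ∀ i ∈ S, ∀ j ∈ S, i ≠ j →
      c i j = C i j - C i z - C z j + (∑ t ∈ S, (C t z + C z t)) / (S.card - 1) := by
    intro i hi j hj hij
    obtain ⟨σ, hσ, rfl, e⟩ := hc i hi j hj hij
    rw [e, candidate]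
    have a := hf σ hσ i hi
    have b := hsum σ hσ
    field_simp
    linear_combination b - (S.card - 1 : ℝ) * a
  rw [linearizesOn_insert hz (card_pos.1 (by omega)) h1 h2]
  intro σ hσ i hi
  rw [hf σ hσ i hi]
  have hn : ∀ i ∈ S, i ≠ σ i := fun i hi => (hσ.ne hS hi).symm
  have : linOn c σ S = linOn C σ S + (∑ t ∈ S, (C t z + C z t)) / (S.card - 1) := by
    have e : linOn c σ S = ∑ i ∈ S, (C i (σ i) - C i z - C z (σ i) +
        (∑ t ∈ S, (C t z + C z t)) / (S.card - 1)) :=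
      sum_congr rfl fun i hi => hc' i hi _ (hσ.mem hi) (hn i hi)
    rw [e, sum_add_distrib, sum_sub_distrib, sum_sub_distrib, hσ.sum_comp fun t => C z t,
      sum_const, nsmul_eq_mul]
    change linOn C σ S - _ - _ + _ = _
    rw [sum_add_distrib]
    field_simp
    ring
  rw [this, hc' i hi _ (hσ.mem hi) (hn i hi)]
  ring

/-- On three or four nodes the extracted costs are always a linearization. -/
theorem linearizesOn_of_card_le_three (hz : z ∉ S) (hS : 1 < S.card) (hS3 : S.card ≤ 3)
    (h1 : ∀ a ∈ S, c a z = 0) (h2 : ∀ b ∈ S, c z b = 0)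
    (hc : ∀ i ∈ S, ∀ j ∈ S, i ≠ j → ∃ σ : Perm α, IsTourOn σ S ∧ σ i = j ∧
      c i j = candidate q z S σ i j) : LinearizesOn c q (insert z S) := by
  have hm : (0 : ℝ) < S.card - 1 := by
    have : (1 : ℝ) < S.card := by exact_mod_cast hS
    linarith
  -- An arc determines its tour here, so all arcs of `σ` use the same tour; what remains is the
  -- identity `sum_insertions`.
  have hc' : ∀ σ : Perm α, IsTourOn σ S → ∀ i ∈ S, c i (σ i) = candidate q z S σ i (σ i) := by
    intro σ hσ i hi
    obtain ⟨σ', hσ', e, e'⟩ := hc i hi _ (hσ.mem hi) (hσ.ne hS hi).symm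
    have heq := hσ'.eqOn_of_card_le_three hσ hS hS3 hi e
    have hlin : ∀ g : α → α → ℝ, linOn g σ' S = linOn g σ S := fun g =>
      sum_congr rfl fun a ha => by rw [heq a ha]
    have hquad : quadOn q σ' S = quadOn q σ S :=
      sum_congr rfl fun a ha => sum_congr rfl fun b hb => by rw [heq a ha, heq b hb]
    rw [e', candidate, candidate, hlin, hlin, hquad]
  rw [linearizesOn_insert hz (card_pos.1 (by omega)) h1 h2]
  intro σ hσ i hi
  have hsum := sum_insertions (q := q) (z := z) hσ
  simp only [add_assoc, sum_add_distrib, sum_const, nsmul_eq_mul] at hsum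
  have : linOn c σ S = ∑ i ∈ S, candidate q z S σ i (σ i) := sum_congr rfl (hc' σ hσ)
  simp only [candidate, sum_sub_distrib, sum_const, nsmul_eq_mul] at this
  rw [this, hc' σ hσ i hi, candidate]
  field_simp
  linear_combination (S.card - 1 : ℝ) * hsum

/-- A linear function takes a prescribed value on all tours through an arc if and only if its
coefficients satisfy one equation for each arc between the other nodes. -/
theorem forall_tours_through_iff {D : α → α → ℝ} {A : ℝ} (hi : i ∈ S) (hj : j ∈ S) (hij : i ≠ j)
    (hS : 3 < S.card) :
    (∀ σ : Perm α, IsTourOn σ S → σ i = j → linOn D σ S + A = 0) ↔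
      ∀ k ∈ S, ∀ l ∈ S, k ≠ i → k ≠ j → l ≠ i → l ≠ j → k ≠ l →
        ((S.card : ℝ) - 3) * (D k l - D k i - D j l) +
          ∑ t ∈ (S.erase i).erase j, (D t i + D j t) + D i j + A = 0 := by
  set S' := (S.erase i).erase j with hS'
  have hjS : j ∈ S.erase i := mem_erase.2 ⟨hij.symm, hj⟩
  have hi' : i ∉ S' := fun h => notMem_erase i S (mem_of_mem_erase h)
  have hj' : j ∉ insert i S' := by simp [hS', hij.symm]
  have hins : insert j (insert i S') = S := by
    rw [Finset.insert_comm, hS', insert_erase hjS, insert_erase hi]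
  have hcard : S'.card + 2 = S.card := by
    rw [← hins, card_insert_of_notMem hj', card_insert_of_notMem hi']
  have hM : (S.card : ℝ) = S'.card + 2 := by exact_mod_cast hcard.symm
  have hM1 : (S'.card : ℝ) - 1 ≠ 0 := by
    have : (2 : ℝ) ≤ S'.card := by exact_mod_cast (by omega : 2 ≤ S'.card)
    linarith
  -- Contraction: a tour through (i, j) is a tour of `S'` in which one arc (k, σ k) is replaced by
  -- the path k, i, j, σ k.
  have key : (∀ σ : Perm α, IsTourOn σ S → σ i = j → linOn D σ S + A = 0) ↔
      ∀ σ : Perm α, IsTourOn σ S' → ∀ k ∈ S',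
        linOn D σ S' + (D k i + D i j + D j (σ k) - D k (σ k)) + A = 0 := by
    have hlin : ∀ σ : Perm α, IsTourOn σ S' → ∀ k ∈ S',
        linOn D (σ * swap k i * swap i j) S =
          linOn D σ S' + (D k i + D i j + D j (σ k) - D k (σ k)) := by
      intro σ hσ k hk
      have h1 := linOn_insert (c := D) (hσ.insert hi' hk) hj' (mem_insert_self i S')
      rw [hins, linOn_insert hσ hi' hk, IsTourOn.mul_swap_right] at h1
      rw [h1]
      ring
    constructor
    · intro h σ hσ k hk
      have hσ1 := hσ.insert hi' hk
      have hσ2 := hσ1.insert hj' (mem_insert_self i S')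
      rw [hins] at hσ2
      rw [← hlin σ hσ k hk]
      exact h _ hσ2 (hσ1.mul_swap_left hj')
    · intro h σ hσ he
      rw [← hins] at hσ
      obtain ⟨σ1, i', hσ1, hi1, rfl⟩ := hσ.exists_insert hj' (insert_nonempty _ _)
      have : i' = i := by
        have h1 : (σ1 * swap i' j) i' = j := hσ1.mul_swap_left hj'
        exact (σ1 * swap i' j).injective (h1.trans he.symm)
      subst this
      obtain ⟨σ2, k, hσ2, hk, rfl⟩ := hσ1.exists_insert hi' (card_pos.1 (by omega))
      rw [hlin _ hσ2 k hk]
      exact h σ2 hσ2 k hk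
  have hsum : ∀ σ : Perm α, IsTourOn σ S' →
      ∑ k ∈ S', (linOn D σ S' + (D k i + D i j + D j (σ k) - D k (σ k)) + A) =
        (S'.card - 1) * linOn D σ S' + ∑ t ∈ S', (D t i + D j t) + S'.card * (D i j + A) := by
    intro σ hσ
    simp only [sum_add_distrib, sum_sub_distrib, sum_const, nsmul_eq_mul]
    rw [hσ.sum_comp fun t => D j t]
    change _ + (_ - linOn D σ S') + _ = _
    ring
  rw [key]
  constructor
  · intro h k hk l hl hki hkj hli hlj hkl
    have hk' : k ∈ S' := mem_erase.2 ⟨hkj, mem_erase.2 ⟨hki, hk⟩⟩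
    have hl' : l ∈ S' := mem_erase.2 ⟨hlj, mem_erase.2 ⟨hli, hl⟩⟩
    obtain ⟨σ, hσ, rfl⟩ := exists_isTourOn hk' hl' hkl
    -- Summing over all insertion places determines the cost of `σ`; eliminating it leaves an
    -- equation in `k` and `σ k` alone.
    have h1 := hsum σ hσ
    rw [sum_congr rfl (h σ hσ), sum_const_zero] at h1
    have h2 := h σ hσ k hk'
    rw [hM]
    linear_combination -h1 - (S'.card - 1 : ℝ) * h2
  · intro h σ hσ k hk
    have h1 : ∀ k ∈ S', ((S'.card : ℝ) - 1) * (D k (σ k) - D k i - D j (σ k)) +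
        ∑ t ∈ S', (D t i + D j t) + D i j + A = 0 := by
      intro k hk
      have hl := hσ.mem hk
      have hkl := hσ.ne (by omega) hk
      rw [hS', mem_erase, mem_erase] at hl
      have hk' := hk
      rw [hS', mem_erase, mem_erase] at hk'
      have := h k hk'.2.2 _ hl.2.2 hk'.2.1 hk'.1 hl.2.1 hl.1 hkl.symm
      rw [hM] at this
      linear_combination this
    -- Adding the equations of all arcs of `σ` gives back the cost of `σ`.
    have h2 : (S'.card - 1) * linOn D σ S' + ∑ t ∈ S', (D t i + D j t) +
        S'.card * (D i j + A) = 0 := by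
      have h3 := sum_congr rfl h1
      rw [sum_const_zero] at h3
      simp only [sum_add_distrib, sum_const, nsmul_eq_mul, ← mul_sum, sum_sub_distrib] at h3 ⊢
      rw [hσ.sum_comp fun t => D j t] at h3
      refine mul_left_cancel₀ hM1 ?_
      change ((S'.card : ℝ) - 1) * (linOn D σ S' - _ - _) + _ + _ + _ = 0 at h3
      linear_combination ((S'.card : ℝ) - 1) * h3
    refine mul_left_cancel₀ hM1 ?_
    linear_combination h2 - h1 k hk

end Costs

end QTSP

/-! ## Tours of `Fin n` and tours of `Finset.range n` -/

namespace QTSP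

open Equiv Finset

/-- Permutations of `ℕ` that fix everything outside a finite set allow nodes to be removed without a
change of type. -/
theorem Tour.exists_isTourOn {n : ℕ} (τ : Tour n) : ∃ σ : Perm ℕ, IsTourOn σ (range n) ∧
    ∀ i : Fin n, σ i = τ.succ i := by
  have happ : ∀ i : Fin n, τ.succ.extendDomain Fin.equivSubtype (i : ℕ) = τ.succ i := fun i =>
    Perm.extendDomain_apply_image τ.succ Fin.equivSubtype i
  have hpow : ∀ (k : ℕ) (i : Fin n),
      ((τ.succ.extendDomain Fin.equivSubtype) ^ k) (i : ℕ) = ((τ.succ ^ k) i : Fin n) := by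
    intro k
    induction k with
    | zero => exact fun i => rfl
    | succ k ih => exact fun i => by rw [pow_succ, Perm.mul_apply, happ, ih, pow_succ,
        Perm.mul_apply]
  refine ⟨τ.succ.extendDomain Fin.equivSubtype, ⟨?_, ?_⟩, happ⟩
  · intro a ha
    exact Perm.extendDomain_apply_not_subtype _ _ (by simpa using ha)
  · intro a ha b hb
    obtain ⟨k, hk⟩ := τ.isCycle.exists_pow_eq (τ.succ_ne ⟨a, mem_range.1 ha⟩)
      (τ.succ_ne ⟨b, mem_range.1 hb⟩)
    exact ⟨k, (hpow k ⟨a, mem_range.1 ha⟩).trans (congrArg Fin.val hk)⟩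

theorem IsTourOn.exists_tour {n : ℕ} (hn : 1 < n) {σ : Perm ℕ} (h : IsTourOn σ (range n)) :
    ∃ τ : Tour n, ∀ i : Fin n, σ i = τ.succ i := by
  let f : Fin n → Fin n := fun i => ⟨σ i, mem_range.1 (h.mem (mem_range.2 i.2))⟩
  have hf : Function.Injective f := fun a b e =>
    Fin.ext (σ.injective (congrArg Fin.val e))
  have hne : ∀ i, f i ≠ i := fun i e =>
    h.ne (by simpa using hn) (mem_range.2 i.2) (congrArg Fin.val e)
  let τ : Perm (Fin n) := Equiv.ofBijective f (Finite.injective_iff_bijective.1 hf)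
  have hpow : ∀ (k : ℕ) (i : Fin n), (((τ ^ k) i : Fin n) : ℕ) = (σ ^ k) i := by
    intro k
    induction k with
    | zero => exact fun i => rfl
    | succ k ih => exact fun i => by rw [pow_succ, Perm.mul_apply, ih, pow_succ]; rfl
  refine ⟨⟨τ, ⟨⟨0, by omega⟩, hne _, fun b _ => ?_⟩, hne⟩, fun i => rfl⟩
  obtain ⟨k, hk⟩ := h.reach 0 (by simp; omega) b (mem_range.2 b.2)
  exact ⟨k, Fin.ext (by rw [zpow_natCast, hpow]; exact hk)⟩

theorem quadCost_eq_quadOn {n : ℕ} (Q : Matrix (Arc n) (Arc n) ℝ) (τ : Tour n) (σ : Perm ℕ)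
    (h : ∀ i : Fin n, σ i = τ.succ i) :
    quadCost Q τ = quadOn ((input n Q).rarr 0) σ (range n) := by
  unfold quadOn
  rw [← Fin.sum_univ_eq_sum_range
    (fun a => ∑ b ∈ range n, (input n Q).rarr 0 a (σ a) b (σ b)) n]
  refine sum_congr rfl fun i _ => ?_
  rw [← Fin.sum_univ_eq_sum_range (fun b => (input n Q).rarr 0 i (σ i) b (σ b)) n]
  refine sum_congr rfl fun k _ => ?_
  have hi : (i : ℕ) ≠ τ.succ i := fun e => τ.succ_ne i (Fin.ext e.symm)
  have hk : (k : ℕ) ≠ τ.succ k := fun e => τ.succ_ne k (Fin.ext e.symm)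
  simp only [input, h]
  rw [dif_pos ⟨trivial, ⟨i.2, (τ.succ i).2, hi⟩, k.2, (τ.succ k).2, hk⟩]
  rfl

theorem linCost_eq_linOn {n : ℕ} (c : ℕ → ℕ → ℝ) (τ : Tour n) (σ : Perm ℕ)
    (h : ∀ i : Fin n, σ i = τ.succ i) :
    linCost (fun i j : Fin n => c i j) τ = linOn c σ (range n) := by
  unfold linOn
  rw [← Fin.sum_univ_eq_sum_range (fun a => c a (σ a)) n]
  exact sum_congr rfl fun i _ => by rw [h]

/-- For `n ≤ 1` the notions of tour differ: the identity satisfies `IsTourOn`, but there is no `Tour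
n`. -/
theorem isLinearization_iff {n : ℕ} (hn : 1 < n) (Q : Matrix (Arc n) (Arc n) ℝ)
    (c : ℕ → ℕ → ℝ) : IsLinearization (fun i j : Fin n => c i j) Q ↔
      LinearizesOn c ((input n Q).rarr 0) (range n) := by
  constructor
  · intro h σ hσ
    obtain ⟨τ, hτ⟩ := hσ.exists_tour hn
    rw [← quadCost_eq_quadOn Q τ σ hτ, ← linCost_eq_linOn c τ σ hτ]
    exact h τ
  · intro h τ
    obtain ⟨σ, hσ, hτ⟩ := τ.exists_isTourOn
    rw [quadCost_eq_quadOn Q τ σ hτ, linCost_eq_linOn c τ σ hτ]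
    exact h σ hσ

theorem Linearizable.exists_linearizesOn {n : ℕ} (hn : 1 < n) {Q : Matrix (Arc n) (Arc n) ℝ}
    (h : Linearizable Q) : ∃ c : ℕ → ℕ → ℝ, LinearizesOn c ((input n Q).rarr 0) (range n) := by
  obtain ⟨C, hC⟩ := h
  refine ⟨fun i j => if h : i < n ∧ j < n then C ⟨i, h.1⟩ ⟨j, h.2⟩ else 0,
    (isLinearization_iff hn Q _).1 ?_⟩
  simpa using hC

theorem not_tour_of_lt_two {n : ℕ} (hn : n < 2) (τ : Tour n) : False := by
  obtain ⟨x, _⟩ := τ.isCycle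
  exact τ.succ_ne x (Fin.ext (by omega))

end QTSP

/-! ## Verification of programs of the real RAM -/

namespace RealRAM

namespace Program

/-- A bound for the running time, if every loop is passed at most `N` times. -/
def bound (N : ℕ) : Program → ℕ
  | skip => 1
  | isetVar _ e => e.cost + 1
  | rsetVar _ e => e.cost + 1
  | isetArr _ i j k l e => i.cost + j.cost + k.cost + l.cost + e.cost + 1
  | rsetArr _ i j k l e => i.cost + j.cost + k.cost + l.cost + e.cost + 1
  | seq p q => p.bound N + q.bound N
  | ite b p q => b.cost + (p.bound N + q.bound N)
  | .while b p => (N + 1) * (b.cost + p.bound N)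

/-- The nesting depth of the loops of a program. -/
def depth : Program → ℕ
  | seq p q => max p.depth q.depth
  | ite _ p q => max p.depth q.depth
  | .while _ p => p.depth + 1
  | _ => 0

theorem exists_bound_le (p : Program) : ∃ K, ∀ N, p.bound N ≤ K * (N + 1) ^ p.depth := by
  have hmono : ∀ {K d d' N : ℕ}, d ≤ d' → K * (N + 1) ^ d ≤ K * (N + 1) ^ d' := fun h =>
    Nat.mul_le_mul_left _ (Nat.pow_le_pow_right (Nat.succ_pos _) h)
  have hone : ∀ {c d N : ℕ}, c ≤ c * (N + 1) ^ d := fun {c d N} =>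
    Nat.le_mul_of_pos_right c (Nat.pow_pos (Nat.succ_pos N))
  induction p with
  | skip => exact ⟨1, fun N => hone⟩
  | isetVar x e => exact ⟨e.cost + 1, fun N => hone⟩
  | rsetVar x e => exact ⟨e.cost + 1, fun N => hone⟩
  | isetArr a i j k l e => exact ⟨_, fun N => hone⟩
  | rsetArr a i j k l e => exact ⟨_, fun N => hone⟩
  | seq p q ihp ihq =>
    obtain ⟨K, hK⟩ := ihp
    obtain ⟨L, hL⟩ := ihq
    refine ⟨K + L, fun N => ?_⟩
    rw [add_mul]
    exact add_le_add ((hK N).trans (hmono (le_max_left _ _)))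
      ((hL N).trans (hmono (le_max_right _ _)))
  | ite b p q ihp ihq =>
    obtain ⟨K, hK⟩ := ihp
    obtain ⟨L, hL⟩ := ihq
    refine ⟨b.cost + (K + L), fun N => ?_⟩
    rw [add_mul, add_mul]
    exact add_le_add hone (add_le_add ((hK N).trans (hmono (le_max_left _ _)))
      ((hL N).trans (hmono (le_max_right _ _))))
  -- The remaining case is the loop, which contributes one factor `N + 1`.
  | _ =>
    rename_i b p ih
    obtain ⟨K, hK⟩ := ih
    refine ⟨b.cost + K, fun N => ?_⟩
    calc (N + 1) * (b.cost + p.bound N)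
        ≤ (N + 1) * (b.cost * (N + 1) ^ p.depth + K * (N + 1) ^ p.depth) :=
          Nat.mul_le_mul_left _ (add_le_add hone (hK N))
      _ = (b.cost + K) * (N + 1) ^ (p.depth + 1) := by ring

theorem isBigO_bound (p : Program) {d : ℕ} (h : p.depth ≤ d) :
    (fun n : ℕ => (p.bound n : ℝ)) =O[Filter.atTop] (fun n : ℕ => (n : ℝ) ^ d) := by
  obtain ⟨K, hK⟩ := p.exists_bound_le
  refine Asymptotics.IsBigO.of_bound (K * 2 ^ d) ?_
  filter_upwards [Filter.eventually_ge_atTop 1] with n hn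
  rw [Real.norm_natCast, norm_pow, Real.norm_natCast]
  have : p.bound n ≤ K * 2 ^ d * n ^ d := by
    calc p.bound n ≤ K * (n + 1) ^ p.depth := hK n
      _ ≤ K * (n + 1) ^ d := Nat.mul_le_mul_left _ (Nat.pow_le_pow_right (Nat.succ_pos _) h)
      _ ≤ K * (2 * n) ^ d := Nat.mul_le_mul_left _ (Nat.pow_le_pow_left (by omega) d)
      _ = K * 2 ^ d * n ^ d := by rw [mul_pow, mul_assoc]
  exact_mod_cast this

/-- `for x < e do p`. -/
def forLoop (x : ℕ) (e : IExpr) (p : Program) : Program :=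
  .seq (.isetVar x (.lit 0))
    (.while (.ilt (.var x) e) (.seq p (.isetVar x (.succ (.var x)))))

/-- The sum of the values of `f` for `x < e`, written to the real variable `r`. -/
def sumLoop (r x : ℕ) (e : IExpr) (f : RExpr) : Program :=
  .seq (.rsetVar r (.lit 0)) (forLoop x e (.rsetVar r (.add (.var r) f)))

/-- Assignment to `x` of the image of `e` under the transposition of `a` and `b`. -/
def setSwap (x : ℕ) (a b e : IExpr) : Program :=
  .ite (.ieq e a) (.isetVar x b) (.ite (.ieq e b) (.isetVar x a) (.isetVar x e))

end Program

namespace State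

/-- The state after an assignment to an integer variable. -/
def setI (s : State) (x v : ℕ) : State :=
  { s with ivar := Function.update s.ivar x v }

/-- The state after an assignment to a real variable. -/
noncomputable def setR (s : State) (x : ℕ) (v : ℝ) : State :=
  { s with rvar := Function.update s.rvar x v }

/-- The state after an assignment to a cell of an integer array. -/
def setIA (s : State) (a i j k l v : ℕ) : State :=
  { s with iarr := setAt s.iarr a i j k l v }

/-- The state after an assignment to a cell of a real array. -/
noncomputable def setRA (s : State) (a i j k l : ℕ) (v : ℝ) : State :=
  { s with rarr := setAt s.rarr a i j k l v }

variable (s : State) (x a i j k l y w : ℕ) (v : ℝ)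

@[simp] theorem setI_ivar : (s.setI x y).ivar w = if w = x then y else s.ivar w := by
  simp [setI, Function.update_apply]
@[simp] theorem setI_rvar : (s.setI x y).rvar = s.rvar := rfl
@[simp] theorem setI_iarr : (s.setI x y).iarr = s.iarr := rfl
@[simp] theorem setI_rarr : (s.setI x y).rarr = s.rarr := rfl
@[simp] theorem setR_ivar : (s.setR x v).ivar = s.ivar := rfl
@[simp] theorem setR_rvar : (s.setR x v).rvar w = if w = x then v else s.rvar w := by
  simp [setR, Function.update_apply]
@[simp] theorem setR_iarr : (s.setR x v).iarr = s.iarr := rfl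
@[simp] theorem setR_rarr : (s.setR x v).rarr = s.rarr := rfl
@[simp] theorem setIA_ivar : (s.setIA a i j k l y).ivar = s.ivar := rfl
@[simp] theorem setIA_iarr : (s.setIA a i j k l y).iarr = setAt s.iarr a i j k l y := rfl
@[simp] theorem setIA_rarr : (s.setIA a i j k l y).rarr = s.rarr := rfl
@[simp] theorem setRA_ivar : (s.setRA a i j k l v).ivar = s.ivar := rfl
@[simp] theorem setRA_rarr : (s.setRA a i j k l v).rarr = setAt s.rarr a i j k l v := rfl

end State

theorem setAt_of_ne {α : Type} (g : ℕ → ℕ → ℕ → ℕ → ℕ → α) {a a' : ℕ} (h : a' ≠ a)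
    (i j k l : ℕ) (v : α) : setAt g a i j k l v a' = g a' := by
  funext i' j' k' l'
  simp [setAt, h]

/-- Started in `s`, the program halts within the time bound for `N` passes of each loop, in a
state that satisfies `B`. -/
def Reaches (N : ℕ) (p : Program) (B : State → Prop) (s : State) : Prop :=
  ∃ t s', Run p s t s' ∧ t ≤ p.bound N ∧ B s'

/-! ### Rules for total correctness with time bounds. -/

namespace Reaches

open Program

variable {N : ℕ} {p q : Program} {b : Test} {B B' : State → Prop} {s : State}

theorem mono (h : Reaches N p B s) (hB : ∀ s, B s → B' s) : Reaches N p B' s := by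
  obtain ⟨t, s', h1, h2, h3⟩ := h
  exact ⟨t, s', h1, h2, hB _ h3⟩

theorem skip (h : B s) : Reaches N .skip B s :=
  ⟨_, _, .skip s, le_rfl, h⟩

theorem isetVar {x : ℕ} {e : IExpr} (h : B (s.setI x (e.eval s))) :
    Reaches N (.isetVar x e) B s :=
  ⟨_, _, .isetVar s x e, le_rfl, h⟩

theorem rsetVar {x : ℕ} {e : RExpr} (h : B (s.setR x (e.eval s))) :
    Reaches N (.rsetVar x e) B s :=
  ⟨_, _, .rsetVar s x e, le_rfl, h⟩

theorem isetArr {a : ℕ} {i j k l e : IExpr}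
    (h : B (s.setIA a (i.eval s) (j.eval s) (k.eval s) (l.eval s) (e.eval s))) :
    Reaches N (.isetArr a i j k l e) B s :=
  ⟨_, _, .isetArr s a i j k l e, le_rfl, h⟩

theorem rsetArr {a : ℕ} {i j k l : IExpr} {e : RExpr}
    (h : B (s.setRA a (i.eval s) (j.eval s) (k.eval s) (l.eval s) (e.eval s))) :
    Reaches N (.rsetArr a i j k l e) B s :=
  ⟨_, _, .rsetArr s a i j k l e, le_rfl, h⟩

/-- Postconditions nest, so a program is verified from its first command on, with times added
automatically. -/
theorem seq (h : Reaches N p (Reaches N q B) s) : Reaches N (.seq p q) B s := by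
  obtain ⟨t, s', h1, h2, t', s'', h3, h4, h5⟩ := h
  exact ⟨_, _, .seq h1 h3, add_le_add h2 h4, h5⟩

theorem ite (h1 : b.holds s → Reaches N p B s) (h2 : ¬ b.holds s → Reaches N q B s) :
    Reaches N (.ite b p q) B s := by
  by_cases hb : b.holds s
  · obtain ⟨t, s', h3, h4, h5⟩ := h1 hb
    exact ⟨_, _, .ite_true hb h3, Nat.add_le_add_left (h4.trans (Nat.le_add_right _ _)) _, h5⟩
  · obtain ⟨t, s', h3, h4, h5⟩ := h2 hb
    exact ⟨_, _, .ite_false hb h3, Nat.add_le_add_left (h4.trans (Nat.le_add_left _ _)) _, h5⟩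

/-- Loops are verified by invariants. -/
theorem forLoop {M x : ℕ} {e : IExpr} (hM : M ≤ N) (I : ℕ → State → Prop)
    (hI : ∀ k s, I k s → s.ivar x = k ∧ e.eval s = M) (h0 : I 0 (s.setI x 0))
    (hs : ∀ k < M, ∀ s, I k s →
      Reaches N p (fun s' => s'.ivar x = k ∧ I (k + 1) (s'.setI x (k + 1))) s)
    (hB : ∀ s, I M s → B s) : Reaches N (forLoop x e p) B s := by
  set b : Test := .ilt (.var x) e with hb
  set p' : Program := .seq p (.isetVar x (.succ (.var x))) with hp'
  -- Here `d` counts the remaining passes. The final failing test costs the extra `b.cost`, covered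
  -- by the `+ 1` in the factor `N + 1`.
  have key : ∀ d k, k + d = M → ∀ s, I k s → ∃ t s', Run (.while b p') s t s' ∧
      t ≤ d * (b.cost + p'.bound N) + b.cost ∧ B s' := by
    intro d
    induction d with
    | zero =>
      intro k hk s hs'
      obtain ⟨h1, h2⟩ := hI k s hs'
      refine ⟨_, s, .while_false ?_, by omega, hB s (hk ▸ hs')⟩
      change ¬ s.ivar x < e.eval s
      omega
    | succ d ih =>
      intro k hk s hs'
      obtain ⟨h1, h2⟩ := hI k s hs'
      obtain ⟨t, s', h3, h4, h5, h6⟩ := hs k (by omega) s hs'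
      have h7 : (IExpr.succ (.var x)).eval s' = k + 1 := congrArg (· + 1) h5
      obtain ⟨t', s'', h8, h9, h10⟩ := ih (k + 1) (by omega) _ h6
      have h11 := Run.isetVar s' x (.succ (.var x))
      rw [h7] at h11
      refine ⟨_, s'', .while_true ?_ (.seq h3 h11) h8, ?_, h10⟩
      · change s.ivar x < e.eval s
        omega
      · have h12 : p'.bound N = p.bound N + ((IExpr.succ (.var x)).cost + 1) := rfl
        rw [add_mul, one_mul]
        omega
  obtain ⟨t, s', h1, h2, h3⟩ := key M 0 (zero_add M) _ h0
  refine seq (isetVar ⟨t, s', h1, h2.trans ?_, h3⟩)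
  change _ ≤ (N + 1) * (b.cost + p'.bound N)
  rw [add_mul, one_mul]
  exact add_le_add (Nat.mul_le_mul_right _ hM) (Nat.le_add_right _ _)

/-- Only `x` and `r` change, so the invariant is an equality of states; the value of the summand
must not depend on the accumulator `r`. -/
theorem sumLoop {M r x : ℕ} {e : IExpr} {f : RExpr} (F : ℕ → ℝ) (hM : M ≤ N)
    (he : ∀ k v, e.eval ((s.setI x k).setR r v) = M)
    (hf : ∀ k < M, ∀ v, f.eval ((s.setI x k).setR r v) = F k)
    (hB : B ((s.setI x M).setR r (∑ k ∈ Finset.range M, F k))) :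
    Reaches N (sumLoop r x e f) B s := by
  refine seq (rsetVar (forLoop hM
    (fun k s' => s' = (s.setI x k).setR r (∑ k ∈ Finset.range k, F k)) ?_ ?_ ?_ ?_))
  · rintro k s' rfl
    exact ⟨by simp, he _ _⟩
  · simp [State.setI, State.setR, RExpr.eval]
  · rintro k hk s' rfl
    refine rsetVar ⟨by simp, ?_⟩
    rw [RExpr.eval, hf k hk, RExpr.eval, Finset.sum_range_succ]
    simp [State.setI, State.setR]
  · rintro s' rfl
    exact hB

theorem setSwap {x : ℕ} {a b e : IExpr}
    (hB : B (s.setI x (Equiv.swap (a.eval s) (b.eval s) (e.eval s)))) :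
    Reaches N (setSwap x a b e) B s := by
  rw [Equiv.swap_apply_def] at hB
  refine ite (fun h => isetVar ?_) fun h => ite (fun h' => isetVar ?_) fun h' => isetVar ?_ <;>
    simp only [Test.holds] at h
  · rwa [if_pos h] at hB
  · simp only [Test.holds] at h'
    rwa [if_neg h, if_pos h'] at hB
  · simp only [Test.holds] at h'
    rwa [if_neg h, if_neg h'] at hB

end Reaches

end RealRAM

/-! ## Loops that fill tables and loops that test conditions -/

namespace RealRAM

open Program

/-- The number stored in the integer variable `0`, minus one. -/
def lastNode : IExpr := .pred (.var 0)

/-- The program `p` is executed for all values of the integer variables `2` and `3` below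
`lastNode`. -/
def tableLoop (p : Program) : Program :=
  forLoop 2 lastNode (forLoop 3 lastNode p)

/-- The number `v` is the truth value of `b`. -/
def Flag (b : Prop) (v : ℕ) : Prop := (b ∧ v = 1) ∨ (¬ b ∧ v = 0)

namespace Reaches

variable {N n : ℕ} {p : Program} {B : State → Prop} {s : State}

theorem tableLoop {a : ℕ} (Γ : State → Prop) (F G : ℕ → ℕ → ℝ) (hN : n - 1 ≤ N)
    (hn : ∀ s, Γ s → s.ivar 0 = n) (hΓ : ∀ s v, Γ s → Γ (s.setI 2 v) ∧ Γ (s.setI 3 v))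
    (hs : Γ s) (hG : ∀ i j, s.rarr a i j 0 0 = G i j)
    (hp : ∀ i < n - 1, ∀ j < n - 1, ∀ s, Γ s → s.ivar 2 = i → s.ivar 3 = j →
      Reaches N p (fun s' => Γ s' ∧ s'.ivar 2 = i ∧ s'.ivar 3 = j ∧
        s'.rarr = setAt s.rarr a i j 0 0 (F i j)) s)
    (hB : ∀ s, Γ s →
      (∀ i j, s.rarr a i j 0 0 = if i < n - 1 ∧ j < n - 1 then F i j else G i j) → B s) :
    Reaches N (tableLoop p) B s := by
  have hm : ∀ s, Γ s → lastNode.eval s = n - 1 := fun s h => congrArg (· - 1) (hn s h)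
  refine forLoop hN (fun i s => s.ivar 2 = i ∧ Γ s ∧ ∀ i' j', s.rarr a i' j' 0 0 =
    if i' < i ∧ j' < n - 1 then F i' j' else G i' j') (fun i s h => ⟨h.1, hm s h.2.1⟩)
    ⟨by simp, (hΓ s 0 hs).1, by simpa using hG⟩ ?_ (fun s h => hB s h.2.1 h.2.2)
  rintro i hi s ⟨h2, hs, ht⟩
  refine forLoop hN (fun j s => s.ivar 3 = j ∧ s.ivar 2 = i ∧ Γ s ∧ ∀ i' j',
    s.rarr a i' j' 0 0 = if (i' < i ∧ j' < n - 1) ∨ (i' = i ∧ j' < j) then F i' j'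
      else G i' j') (fun j s h => ⟨h.1, hm s h.2.2.1⟩)
    ⟨by simp, by simpa using h2, (hΓ s 0 hs).2, by simpa using ht⟩ ?_ ?_
  · rintro j hj s ⟨h3, h2, hs, ht⟩
    refine (hp i hi j hj s hs h2 h3).mono ?_
    rintro s' ⟨hs', h2', h3', hr⟩
    refine ⟨h3', by simp, by simpa using h2', (hΓ s' _ hs').2, fun i' j' => ?_⟩
    rw [State.setI_rarr, hr]
    simp only [setAt, true_and, and_true, ht]
    by_cases h : i' = i ∧ j' = j
    · rw [if_pos h, if_pos (by omega), h.1, h.2]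
    · rw [if_neg h]
      exact if_congr (by omega) rfl rfl
  · rintro s ⟨h3, h2, hs, ht⟩
    refine ⟨h2, by simp, (hΓ s _ hs).1, fun i' j' => ?_⟩
    rw [State.setI_rarr, ht]
    exact if_congr (by omega) rfl rfl

/-- The proposition `b` records the tests already made, so that nested loops share one flag. -/
theorem forallLoop {x M : ℕ} {e : IExpr} {b : Prop} (Γ : State → Prop) (P : ℕ → Prop)
    (hM : M ≤ N) (hx : x ≠ 1) (he : ∀ s, Γ s → e.eval s = M)
    (hΓ : ∀ s v, Γ s → Γ (s.setI x v)) (hs : Γ s) (hb : Flag b (s.ivar 1))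
    (hp : ∀ k < M, ∀ b s, Γ s → s.ivar x = k → Flag b (s.ivar 1) →
      Reaches N p (fun s' => (Γ s' ∧ s'.ivar x = k) ∧ Flag (b ∧ P k) (s'.ivar 1)) s)
    (hB : ∀ s, Γ s → Flag (b ∧ ∀ k < M, P k) (s.ivar 1) → B s) :
    Reaches N (Program.forLoop x e p) B s := by
  refine forLoop hM (fun k s => s.ivar x = k ∧ Γ s ∧ Flag (b ∧ ∀ k' < k, P k') (s.ivar 1))
    (fun k s h => ⟨h.1, he s h.2.1⟩) ⟨by simp, hΓ _ _ hs, by simpa [hx.symm] using hb⟩ ?_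
    (fun s h => hB s h.2.1 h.2.2)
  rintro k hk s ⟨h1, h2, h3⟩
  refine (hp k hk _ s h2 h1 h3).mono ?_
  rintro s' ⟨⟨h4, h5⟩, h6⟩
  refine ⟨h5, by simp, hΓ _ _ h4, ?_⟩
  rw [State.setI_ivar, if_neg hx.symm]
  have : (b ∧ ∀ k' < k + 1, P k') ↔ ((b ∧ ∀ k' < k, P k') ∧ P k) := by
    rw [Nat.forall_lt_succ_right, and_assoc]
  rwa [this]

end Reaches

end RealRAM

/-! ## The program -/

namespace QTSP

open RealRAM RealRAM.Program Finset

/-- The cell `[a, b, c, d]` of the array of quadratic costs. -/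
def qE (a b c d : IExpr) : RExpr := .get 0 a b c d

/-- The symmetrized quadratic cost as an expression. -/
def sqE (a b c d : IExpr) : RExpr := .add (qE a b c d) (qE c d a b)

/-- `insLin` as an expression. -/
def insLinE (i j a b : IExpr) : RExpr :=
  .sub (.add (sqE i lastNode a b) (sqE lastNode j a b)) (sqE i j a b)

/-- `insConst` as an expression. -/
def insConstE (i j : IExpr) : RExpr :=
  .sub (.sub (.add (.add (.add (qE i j i j) (qE i lastNode i lastNode))
    (qE lastNode j lastNode j)) (sqE i lastNode lastNode j)) (sqE i j i lastNode))
    (sqE i j lastNode j)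

/-- The cell `[a, b]` of a table of real numbers. -/
def tableE (t : ℕ) (a b : IExpr) : RExpr := .get t a b (.lit 0) (.lit 0)

/-- `residual` as an expression. -/
def residualE (i j a b : IExpr) : RExpr :=
  .add (.sub (.mul (.sub (.cast lastNode) (.lit 2)) (insLinE i j a b)) (tableE 2 a b))
    (tableE 1 a b)

/-- The cell `t` of the list of nodes of a tour. -/
def nodeE (t : IExpr) : IExpr := .get 0 t (.lit 0) (.lit 0) (.lit 0)

/-- Fills the table `2` with the values of `insTotal`. -/
def totalProgram : Program :=
  tableLoop (.seq
    (sumLoop 0 6 lastNode (.add (sqE (.var 6) lastNode (.var 2) (.var 3))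
      (sqE lastNode (.var 6) (.var 2) (.var 3))))
    (.rsetArr 2 (.var 2) (.var 3) (.lit 0) (.lit 0)
      (.add (insConstE (.var 2) (.var 3)) (.var 0))))

/-- Lists the nodes of a tour through the arc given by the variables `2` and `3`. -/
def tourProgram : Program :=
  .seq (setSwap 8 (.var 2) (.lit 0) (.var 3)) (.seq
    (forLoop 6 lastNode (.seq (setSwap 9 (.lit 1) (.var 8) (.var 6)) (.seq
      (setSwap 9 (.var 2) (.lit 0) (.var 9))
      (.isetArr 0 (.var 6) (.lit 0) (.lit 0) (.lit 0) (.var 9)))))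
    (.isetArr 0 lastNode (.lit 0) (.lit 0) (.lit 0) (.var 2)))

/-- The sum of the quadratic costs of the listed tour, written to the real variable `0`. -/
def quadProgram : Program :=
  .seq (.rsetVar 0 (.lit 0)) (forLoop 6 lastNode (.seq
    (sumLoop 1 7 lastNode (qE (nodeE (.var 6)) (nodeE (.succ (.var 6))) (nodeE (.var 7))
      (nodeE (.succ (.var 7)))))
    (.rsetVar 0 (.add (.var 0) (.var 1)))))

/-- Fills the table `1` with the costs extracted from tours. -/
def candidateProgram : Program :=
  tableLoop (.seq tourProgram (.seq quadProgram (.seq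
    (sumLoop 2 6 lastNode (tableE 2 (nodeE (.var 6)) (nodeE (.succ (.var 6))))) (.seq
    (sumLoop 3 6 lastNode (insLinE (.var 2) (.var 3) (nodeE (.var 6)) (nodeE (.succ (.var 6)))))
    (.rsetArr 1 (.var 2) (.var 3) (.lit 0) (.lit 0)
      (.sub (.sub (.div (.sub (.var 2) (.var 0)) (.sub (.cast lastNode) (.lit 1))) (.var 3))
        (insConstE (.var 2) (.var 3))))))))

/-- The equation tested by `checkProgram`, for the nodes in the variables `2`, `3`, `4`, `5`. -/
def equationE : RExpr :=
  .add (.add (.add (.mul (.sub (.cast lastNode) (.lit 3))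
      (.sub (.sub (residualE (.var 2) (.var 3) (.var 4) (.var 5))
        (residualE (.var 2) (.var 3) (.var 4) (.var 2)))
        (residualE (.var 2) (.var 3) (.var 3) (.var 5))))
    (.sub (.sub (.var 0)
      (.add (residualE (.var 2) (.var 3) (.var 2) (.var 2))
        (residualE (.var 2) (.var 3) (.var 3) (.var 2))))
      (.add (residualE (.var 2) (.var 3) (.var 3) (.var 2))
        (residualE (.var 2) (.var 3) (.var 3) (.var 3)))))
    (residualE (.var 2) (.var 3) (.var 2) (.var 3)))
    (.mul (.sub (.cast lastNode) (.lit 2))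
      (.add (insConstE (.var 2) (.var 3)) (tableE 1 (.var 2) (.var 3))))

/-- The integer variables `x` and `y` are different. -/
def varNe (x y : ℕ) : Test := .neg (.ieq (.var x) (.var y))

/-- The variables `2`, `3`, `4`, `5` are distinct and violate the equation. -/
def violation : Test :=
  .conj (.conj (.conj (varNe 2 3) (varNe 4 2)) (.conj (varNe 4 3) (varNe 5 2)))
    (.conj (.conj (varNe 5 3) (varNe 4 5)) (.neg (.req equationE (.lit 0))))

/-- Changes the answer to `0` if the table `1` is not a linearization. -/
def checkProgram : Program :=
  forLoop 2 lastNode (forLoop 3 lastNode (.seq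
    (sumLoop 0 6 lastNode (.add (residualE (.var 2) (.var 3) (.var 6) (.var 2))
      (residualE (.var 2) (.var 3) (.var 3) (.var 6))))
    (forLoop 4 lastNode (forLoop 5 lastNode
      (.ite violation (.isetVar 1 (.lit 0)) .skip)))))

/-- On two nodes there is only one tour. -/
def twoNodesProgram : Program :=
  .rsetArr 1 (.lit 0) (.lit 1) (.lit 0) (.lit 0)
    (.add (.add (qE (.lit 0) (.lit 1) (.lit 0) (.lit 1)) (qE (.lit 0) (.lit 1) (.lit 1) (.lit 0)))
      (.add (qE (.lit 1) (.lit 0) (.lit 0) (.lit 1)) (qE (.lit 1) (.lit 0) (.lit 1) (.lit 0))))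

/-- The program that solves the linearization problem. -/
def linearizationProgram : Program :=
  .seq (.isetVar 1 (.lit 1))
    (.ite (.ilt (.var 0) (.lit 2)) .skip
      (.ite (.ieq (.var 0) (.lit 2)) twoNodesProgram
        (.seq totalProgram (.seq candidateProgram
          (.ite (.ilt (.var 0) (.lit 5)) .skip checkProgram)))))

/-- The deepest nests have four loops: two over arcs of a listed tour inside the loops over (i, j),
and the loops over i, j, k, l of the test. -/
theorem depth_linearizationProgram : linearizationProgram.depth ≤ 5 := by decide

/-- The number `n - 1` is both the inserted node and the number of the other nodes. -/
theorem eval_insLinE (s : State) (i j a b : IExpr) : (insLinE i j a b).eval s =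
    insLin (s.rarr 0) (s.ivar 0 - 1) (i.eval s) (j.eval s) (a.eval s) (b.eval s) := rfl

theorem eval_insConstE (s : State) (i j : IExpr) : (insConstE i j).eval s =
    insConst (s.rarr 0) (s.ivar 0 - 1) (i.eval s) (j.eval s) := rfl

theorem eval_residualE (s : State) (i j a b : IExpr) : (residualE i j a b).eval s =
    (((s.ivar 0 - 1 : ℕ) : ℝ) - 2) *
      insLin (s.rarr 0) (s.ivar 0 - 1) (i.eval s) (j.eval s) (a.eval s) (b.eval s) -
      s.rarr 2 (a.eval s) (b.eval s) 0 0 + s.rarr 1 (a.eval s) (b.eval s) 0 0 := by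
  simp [residualE, RExpr.eval, eval_insLinE, tableE, lastNode, IExpr.eval]

end QTSP

/-! ## Correctness of the program -/

namespace QTSP

open RealRAM RealRAM.Program Finset

/-- The nodes of a tour of `range m` through the arc `(i, j)`; the first one is repeated at the
end. -/
def tourNode (m i j t : ℕ) : ℕ :=
  if t = m then i else Equiv.swap i 0 (Equiv.swap 1 (Equiv.swap i 0 j) t)

/-- Turns sums over the arcs of a tour into sums over consecutive entries of a list, which loops can
compute. -/
theorem exists_isTourOn_tourNode {m i j : ℕ} (hm : 2 ≤ m) (hi : i < m) (hj : j < m) (hij : i ≠ j) :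
    ∃ σ : Equiv.Perm ℕ, IsTourOn σ (range m) ∧ σ i = j ∧ (∀ t < m, tourNode m i j t < m) ∧
      ∀ g : ℕ → ℕ → ℝ, ∑ a ∈ range m, g a (σ a) =
        ∑ t ∈ range m, g (tourNode m i j t) (tourNode m i j (t + 1)) := by
  obtain ⟨m, rfl⟩ : ∃ k, m = k + 1 := ⟨m - 1, by omega⟩
  obtain ⟨ρ, hρ, h1, h2⟩ := exists_isTourOn_range m
  set y := Equiv.swap i 0 j with hy
  have hswap : ∀ a b : ℕ, a < m + 1 → b < m + 1 → ∀ x, x < m + 1 → Equiv.swap a b x < m + 1 := by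
    intro a b ha hb x hx
    rw [Equiv.swap_apply_def]
    split_ifs <;> assumption
  have hym : y < m + 1 := hswap i 0 hi (by omega) j hj
  -- The choice of `y` makes `π` send 1 to `j`, and `y ≠ 0` ensures that 0 still goes to `i`.
  set π : Equiv.Perm ℕ := Equiv.swap i 0 * Equiv.swap 1 y with hπ
  have hlt : ∀ x, x < m + 1 → π x < m + 1 := fun x hx =>
    hswap i 0 hi (by omega) _ (hswap 1 y (by omega) hym x hx)
  have hlt' : ∀ x, x < m + 1 → π⁻¹ x < m + 1 := by
    intro x hx
    rw [hπ, mul_inv_rev, Equiv.swap_inv, Equiv.swap_inv]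
    exact hswap 1 y (by omega) hym _ (hswap i 0 hi (by omega) x hx)
  have hmem : ∀ a, π a ∈ range (m + 1) ↔ a ∈ range (m + 1) := by
    intro a
    rw [mem_range, mem_range]
    refine ⟨fun h => ?_, hlt a⟩
    have := hlt' _ h
    rwa [← Equiv.Perm.mul_apply, inv_mul_cancel, Equiv.Perm.one_apply] at this
  have hy0 : y ≠ 0 := by
    rw [hy]
    intro e
    have := (Equiv.swap i 0).injective (e.trans (Equiv.swap_apply_left i 0).symm)
    exact hij this.symm
  have hπ0 : π 0 = i := by
    rw [hπ, Equiv.Perm.mul_apply, Equiv.swap_apply_of_ne_of_ne (by omega) hy0.symm,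
      Equiv.swap_apply_right]
  have hπ1 : π 1 = j := by
    rw [hπ, Equiv.Perm.mul_apply, Equiv.swap_apply_left, hy, Equiv.swap_apply_self]
  have hnode : ∀ t < m + 1, tourNode (m + 1) i j t = π t := fun t ht => by
    rw [tourNode, if_neg (by omega)]
    rfl
  have hnode' : ∀ t < m + 1, tourNode (m + 1) i j (t + 1) = π (ρ t) := fun t ht => by
    by_cases h : t = m
    · rw [h, h2, hπ0, tourNode, if_pos rfl]
    · rw [h1 t (by omega), hnode _ (by omega)]
  have hinv : ∀ t, π⁻¹ (π t) = t := fun t => by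
    rw [← Equiv.Perm.mul_apply, inv_mul_cancel, Equiv.Perm.one_apply]
  refine ⟨π * ρ * π⁻¹, hρ.conj hmem, ?_, fun t ht => hnode t ht ▸ hlt t ht, fun g => ?_⟩
  · rw [Equiv.Perm.mul_apply, Equiv.Perm.mul_apply, ← hπ0, hinv, h1 0 (by omega), hπ1]
  · symm
    refine sum_bij (fun t _ => π t) (fun t ht => (hmem t).2 ht) (fun _ _ _ _ e => π.injective e)
      (fun b hb => ⟨π⁻¹ b, mem_range.2 (hlt' b (mem_range.1 hb)), ?_⟩) (fun t ht => ?_)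
    · rw [← Equiv.Perm.mul_apply, mul_inv_cancel, Equiv.Perm.one_apply]
    · rw [hnode t (mem_range.1 ht), hnode' t (mem_range.1 ht)]
      change g (π t) (π (ρ t)) = g (π t) (π (ρ (π⁻¹ (π t))))
      rw [hinv]

/-- The value computed by the program for the cost of the arc `(i, j)`, if the array `2` has the
contents `P`. -/
noncomputable def listedCandidate (q P : ℕ → ℕ → ℕ → ℕ → ℝ) (m i j : ℕ) : ℝ :=
  (∑ t ∈ range m, P (tourNode m i j t) (tourNode m i j (t + 1)) 0 0 -
    ∑ t ∈ range m, ∑ u ∈ range m, q (tourNode m i j t) (tourNode m i j (t + 1))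
      (tourNode m i j u) (tourNode m i j (u + 1))) / ((m : ℝ) - 1) -
    ∑ t ∈ range m, insLin q m i j (tourNode m i j t) (tourNode m i j (t + 1)) - insConst q m i j

theorem exists_candidate_eq {q P : ℕ → ℕ → ℕ → ℕ → ℝ} {m i j : ℕ}
    (hP : ∀ a < m, ∀ b < m, P a b 0 0 = insTotal q m (range m) a b) (hm : 2 ≤ m) (hi : i < m)
    (hj : j < m) (hij : i ≠ j) : ∃ σ : Equiv.Perm ℕ, IsTourOn σ (range m) ∧ σ i = j ∧
      listedCandidate q P m i j = candidate q m (range m) σ i j := by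
  obtain ⟨σ, hσ, he, hlt, hsum⟩ := exists_isTourOn_tourNode hm hi hj hij
  refine ⟨σ, hσ, he, ?_⟩
  have h1 : ∑ t ∈ range m, P (tourNode m i j t) (tourNode m i j (t + 1)) 0 0 =
      linOn (insTotal q m (range m)) σ (range m) := by
    rw [← hsum fun a b => P a b 0 0]
    exact sum_congr rfl fun a ha =>
      hP a (mem_range.1 ha) _ (mem_range.1 (hσ.mem ha))
  have h2 : ∑ t ∈ range m, ∑ u ∈ range m, q (tourNode m i j t) (tourNode m i j (t + 1))
      (tourNode m i j u) (tourNode m i j (u + 1)) = quadOn q σ (range m) := by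
    unfold quadOn
    rw [hsum fun a b => ∑ x ∈ range m, q a b x (σ x)]
    exact sum_congr rfl fun t _ => (hsum _).symm
  rw [listedCandidate, candidate, h1, h2, ← hsum (insLin q m i j), card_range]
  rfl

/-! ### Verification of the subprograms. -/

theorem reaches_totalProgram {n : ℕ} {s : State} {q : ℕ → ℕ → ℕ → ℕ → ℝ} {B : State → Prop}
    (h0 : s.ivar 0 = n) (h1 : s.ivar 1 = 1) (hq : s.rarr 0 = q)
    (hc : ∀ i j, s.rarr 1 i j 0 0 = 0)
    (hB : ∀ s, s.ivar 0 = n → s.ivar 1 = 1 → s.rarr 0 = q → (∀ i j, s.rarr 1 i j 0 0 = 0) →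
      (∀ a < n - 1, ∀ b < n - 1,
        s.rarr 2 a b 0 0 = insTotal q (n - 1) (range (n - 1)) a b) → B s) :
    Reaches n totalProgram B s := by
  refine Reaches.tableLoop (n := n) (a := 2) (fun s => s.ivar 0 = n ∧ s.ivar 1 = 1 ∧ s.rarr 0 = q ∧
    ∀ i j, s.rarr 1 i j 0 0 = 0) (insTotal q (n - 1) (range (n - 1)))
    (fun i j => s.rarr 2 i j 0 0) (Nat.sub_le n 1) (fun s h => h.1) (fun s v h => ?_)
    ⟨h0, h1, hq, hc⟩ (fun i j => rfl) ?_ ?_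
  · simpa using h
  · rintro i hi j hj s ⟨h0, h1, hq, hc⟩ h2 h3
    refine .seq (.sumLoop (M := n - 1) (fun t => sq q t (n - 1) i j + sq q (n - 1) t i j)
      (Nat.sub_le n 1) ?_ ?_ (.rsetArr ?_))
    · simp [lastNode, IExpr.eval, h0]
    · intro t _ v
      simp [RExpr.eval, sqE, qE, IExpr.eval, lastNode, h0, h2, h3, hq, sq]
    · refine ⟨⟨by simpa using h0, by simpa using h1, ?_, ?_⟩, by simpa using h2,
        by simpa using h3, ?_⟩
      · simpa [setAt_of_ne] using hq
      · simpa [setAt_of_ne] using hc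
      · simp [RExpr.eval, IExpr.eval, eval_insConstE, h0, h2, h3, hq, insTotal]
  · rintro s ⟨h0, h1, hq, hc⟩ ht
    refine hB s h0 h1 hq hc fun a ha b hb => ?_
    rw [ht, if_pos ⟨ha, hb⟩]

theorem reaches_tourProgram {n i j : ℕ} {s : State} {B : State → Prop}
    (h0 : s.ivar 0 = n) (h2 : s.ivar 2 = i) (h3 : s.ivar 3 = j)
    (hB : ∀ s', s'.ivar 0 = n → s'.ivar 1 = s.ivar 1 → s'.ivar 2 = i → s'.ivar 3 = j →
      s'.rarr = s.rarr → (∀ t ≤ n - 1, s'.iarr 0 t 0 0 0 = tourNode (n - 1) i j t) → B s') :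
    Reaches n tourProgram B s := by
  refine .seq (.setSwap (.seq (.forLoop (Nat.sub_le n 1) (fun t s' => s'.ivar 6 = t ∧
    s'.ivar 0 = n ∧ s'.ivar 1 = s.ivar 1 ∧ s'.ivar 2 = i ∧ s'.ivar 3 = j ∧
    s'.ivar 8 = Equiv.swap i 0 j ∧ s'.rarr = s.rarr ∧ ∀ u < t, s'.iarr 0 u 0 0 0 =
      Equiv.swap i 0 (Equiv.swap 1 (Equiv.swap i 0 j) u)) ?_ ?_ ?_ ?_)))
  · rintro t s' ⟨h6, h0, _⟩
    exact ⟨h6, congrArg (· - 1) h0⟩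
  · simp [IExpr.eval, h0, h2, h3]
  · rintro t ht s' ⟨h6, h0, h1, h2, h3, h8, hr, hL⟩
    refine .seq (.setSwap (.seq (.setSwap (.isetArr ?_))))
    refine ⟨by simpa using h6, by simp, by simpa using h0, by simpa using h1, by simpa using h2,
      by simpa using h3, by simpa using h8, by simpa using hr, fun u hu => ?_⟩
    simp only [State.setI_iarr, State.setIA_iarr, setAt, IExpr.eval, State.setI_ivar, h2, h6, h8]
    by_cases h : u = t
    · simp [h]
    · simpa [h] using hL u (by omega)
  · rintro s' ⟨h6, h0, h1, h2, h3, h8, hr, hL⟩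
    refine .isetArr (hB _ (by simpa using h0) (by simpa using h1) (by simpa using h2)
      (by simpa using h3) (by simpa using hr) fun t ht => ?_)
    simp only [State.setIA_iarr, setAt, IExpr.eval, lastNode, h0, h2, tourNode]
    by_cases h : t = n - 1
    · simp [h]
    · simpa [h] using hL t (by omega)

theorem reaches_quadProgram {n : ℕ} {s : State} {B : State → Prop} (L : ℕ → ℕ)
    (h0 : s.ivar 0 = n) (hL : ∀ t ≤ n - 1, s.iarr 0 t 0 0 0 = L t)
    (hB : ∀ s', s'.ivar 0 = n → s'.ivar 1 = s.ivar 1 → s'.ivar 2 = s.ivar 2 →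
      s'.ivar 3 = s.ivar 3 → s'.rarr = s.rarr → s'.iarr = s.iarr →
      s'.rvar 0 = ∑ t ∈ range (n - 1), ∑ u ∈ range (n - 1),
        s.rarr 0 (L t) (L (t + 1)) (L u) (L (u + 1)) → B s') : Reaches n quadProgram B s := by
  refine .seq (.rsetVar (.forLoop (Nat.sub_le n 1) (fun t s' => s'.ivar 6 = t ∧ s'.ivar 0 = n ∧
    s'.ivar 1 = s.ivar 1 ∧ s'.ivar 2 = s.ivar 2 ∧ s'.ivar 3 = s.ivar 3 ∧ s'.rarr = s.rarr ∧
    s'.iarr = s.iarr ∧ s'.rvar 0 = ∑ t ∈ range t, ∑ u ∈ range (n - 1),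
        s.rarr 0 (L t) (L (t + 1)) (L u) (L (u + 1))) ?_ ?_ ?_ ?_))
  · rintro t s' ⟨h6, h0, _⟩
    exact ⟨h6, congrArg (· - 1) h0⟩
  · simp [RExpr.eval, h0]
  · rintro t ht s' ⟨h6, h0, h1, h2, h3, hr, hi, hv⟩
    refine .seq (.sumLoop (M := n - 1)
      (fun u => s.rarr 0 (L t) (L (t + 1)) (L u) (L (u + 1))) (Nat.sub_le n 1) ?_ ?_
      (.rsetVar ?_))
    · simp [lastNode, IExpr.eval, h0]
    · intro u hu v
      simp [RExpr.eval, qE, nodeE, IExpr.eval, h6, hr, hi, hL t (by omega),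
        hL (t + 1) (by omega), hL u (by omega), hL (u + 1) (by omega)]
    · simp [RExpr.eval, h6, h0, h1, h2, h3, hr, hi, hv, sum_range_succ]
  · rintro s' ⟨h6, h0, h1, h2, h3, hr, hi, hv⟩
    exact hB s' h0 h1 h2 h3 hr hi hv

theorem reaches_candidateProgram {n : ℕ} {s : State} {q P : ℕ → ℕ → ℕ → ℕ → ℝ}
    {B : State → Prop} (h0 : s.ivar 0 = n) (h1 : s.ivar 1 = 1) (hq : s.rarr 0 = q)
    (hP : s.rarr 2 = P) (hc : ∀ i j, s.rarr 1 i j 0 0 = 0)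
    (hB : ∀ s, s.ivar 0 = n → s.ivar 1 = 1 → s.rarr 0 = q → s.rarr 2 = P →
      (∀ i j, s.rarr 1 i j 0 0 =
        if i < n - 1 ∧ j < n - 1 then listedCandidate q P (n - 1) i j else 0) → B s) :
    Reaches n candidateProgram B s := by
  refine Reaches.tableLoop (n := n) (a := 1) (fun s => s.ivar 0 = n ∧ s.ivar 1 = 1 ∧ s.rarr 0 = q ∧
    s.rarr 2 = P) (listedCandidate q P (n - 1)) (fun i j => 0) (Nat.sub_le n 1) (fun s h => h.1)
    (fun s v h => ?_) ⟨h0, h1, hq, hP⟩ hc ?_ ?_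
  · simpa using h
  · rintro i hi j hj s ⟨h0, h1, hq, hP⟩ h2 h3
    refine .seq (reaches_tourProgram h0 h2 h3 fun s1 a0 a1 a2 a3 ar hL => .seq ?_)
    refine reaches_quadProgram (tourNode (n - 1) i j) a0 hL fun s2 b0 b1 b2 b3 br bi bv => ?_
    rw [a1, h1] at b1
    rw [a2] at b2
    rw [a3] at b3
    rw [ar] at br bv
    rw [hq] at bv
    rw [← bi] at hL
    refine .seq (.sumLoop (M := n - 1)
      (fun t => P (tourNode (n - 1) i j t) (tourNode (n - 1) i j (t + 1)) 0 0)
      (Nat.sub_le n 1) ?_ ?_ (.seq (.sumLoop (M := n - 1) (fun t => insLin q (n - 1) i j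
        (tourNode (n - 1) i j t) (tourNode (n - 1) i j (t + 1))) (Nat.sub_le n 1) ?_ ?_
        (.rsetArr ?_))))
    · simp [lastNode, IExpr.eval, b0]
    · intro t ht v
      simp [RExpr.eval, tableE, nodeE, IExpr.eval, br, hP, hL t (by omega),
        hL (t + 1) (by omega)]
    · simp [lastNode, IExpr.eval, b0]
    · intro t ht v
      simp [eval_insLinE, nodeE, IExpr.eval, b0, b2, b3, br, hq, hL t (by omega),
        hL (t + 1) (by omega)]
    · refine ⟨⟨by simpa using b0, by simpa using b1, ?_, ?_⟩, by simpa using b2,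
        by simpa using b3, ?_⟩
      · simpa [setAt_of_ne, br] using hq
      · simpa [setAt_of_ne, br] using hP
      · simp [RExpr.eval, IExpr.eval, eval_insConstE, lastNode, b0, b2, b3, br, bv, hq,
          listedCandidate]
  · rintro s ⟨h0, h1, hq, hP⟩ ht
    exact hB s h0 h1 hq hP ht

/-- The equation tested by the program, if the real arrays have the contents `r`. -/
def Equation (r : ℕ → ℕ → ℕ → ℕ → ℕ → ℝ) (m i j k l : ℕ) : Prop :=
  let D : ℕ → ℕ → ℝ := fun a b =>
    ((m : ℝ) - 2) * insLin (r 0) m i j a b - r 2 a b 0 0 + r 1 a b 0 0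
  ((m : ℝ) - 3) * (D k l - D k i - D j l) +
    -- The subtracted terms remove t = i and t = j from the sum, so the meaningless diagonal values
    -- cancel.
    (∑ t ∈ range m, (D t i + D j t) - (D i i + D j i) - (D j i + D j j)) + D i j +
    ((m : ℝ) - 2) * (insConst (r 0) m i j + r 1 i j 0 0) = 0

theorem reaches_checkProgram {n : ℕ} {s : State} {r : ℕ → ℕ → ℕ → ℕ → ℕ → ℝ}
    {B : State → Prop} (h0 : s.ivar 0 = n) (h1 : s.ivar 1 = 1) (hr : s.rarr = r)
    (hB : ∀ s, s.rarr = r → Flag (∀ i < n - 1, ∀ j < n - 1, ∀ k < n - 1, ∀ l < n - 1,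
      i ≠ j ∧ k ≠ i ∧ k ≠ j ∧ l ≠ i ∧ l ≠ j ∧ k ≠ l → Equation r (n - 1) i j k l) (s.ivar 1) →
      B s) : Reaches n checkProgram B s := by
  have hm : ∀ s : State, s.ivar 0 = n → lastNode.eval s = n - 1 := fun s h =>
    congrArg (· - 1) h
  refine .forallLoop (b := True) (fun s => s.ivar 0 = n ∧ s.rarr = r) _ (Nat.sub_le n 1)
    (by omega) (fun s h => hm s h.1) (fun s v h => by simpa using h) ⟨h0, hr⟩ (.inl ⟨trivial, h1⟩)
    ?_ (fun s h hf => hB s h.2 (by simpa only [true_and] using hf))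
  rintro i hi b s ⟨h0, hr⟩ h2 hb
  refine .forallLoop (fun s => (s.ivar 0 = n ∧ s.rarr = r) ∧ s.ivar 2 = i) _ (Nat.sub_le n 1)
    (by omega) (fun s h => hm s h.1.1) (fun s v h => by simpa using h) ⟨⟨h0, hr⟩, h2⟩ hb ?_
    (fun s h hf => ⟨h, hf⟩)
  rintro j hj b s ⟨⟨h0, hr⟩, h2⟩ h3 hb
  set D : ℕ → ℕ → ℝ := fun a b =>
    (((n - 1 : ℕ) : ℝ) - 2) * insLin (r 0) (n - 1) i j a b - r 2 a b 0 0 + r 1 a b 0 0 with hD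
  refine .seq (.sumLoop (M := n - 1) (fun t => D t i + D j t) (Nat.sub_le n 1) ?_ ?_ ?_)
  · simp [lastNode, IExpr.eval, h0]
  · intro t ht v
    simp [RExpr.eval, eval_residualE, IExpr.eval, h0, h2, h3, hr, hD]
  refine .forallLoop (fun s => (s.ivar 0 = n ∧ s.rarr = r) ∧ s.ivar 2 = i ∧ s.ivar 3 = j ∧
    s.rvar 0 = ∑ t ∈ range (n - 1), (D t i + D j t)) _ (Nat.sub_le n 1) (by omega)
    (fun s h => hm s h.1.1) (fun s v h => by simpa using h) ?_ (by simpa using hb) ?_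
    (fun s h hf => ⟨⟨⟨h.1, h.2.1⟩, h.2.2.1⟩, hf⟩)
  · simp [h0, h2, h3, hr]
  rintro k hk b s ⟨⟨h0, hr⟩, h2, h3, hv⟩ h4 hb
  refine .forallLoop (fun s => ((s.ivar 0 = n ∧ s.rarr = r) ∧ s.ivar 2 = i ∧ s.ivar 3 = j ∧
    s.rvar 0 = ∑ t ∈ range (n - 1), (D t i + D j t)) ∧ s.ivar 4 = k) _ (Nat.sub_le n 1) (by omega)
    (fun s h => hm s h.1.1.1) (fun s v h => by simpa using h) ⟨⟨⟨h0, hr⟩, h2, h3, hv⟩, h4⟩ hb ?_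
    (fun s h hf => ⟨h, hf⟩)
  rintro l hl b s ⟨⟨⟨h0, hr⟩, h2, h3, hv⟩, h4⟩ h5 hb
  have hviol : violation.holds s ↔ ¬ (i ≠ j ∧ k ≠ i ∧ k ≠ j ∧ l ≠ i ∧ l ≠ j ∧ k ≠ l →
      Equation r (n - 1) i j k l) := by
    have he : equationE.eval s = (((n - 1 : ℕ) : ℝ) - 3) * (D k l - D k i - D j l) +
        (∑ t ∈ range (n - 1), (D t i + D j t) - (D i i + D j i) - (D j i + D j j)) + D i j +
        (((n - 1 : ℕ) : ℝ) - 2) * (insConst (r 0) (n - 1) i j + r 1 i j 0 0) := by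
      simp [equationE, RExpr.eval, eval_residualE, eval_insConstE, tableE, IExpr.eval, lastNode,
        h0, h2, h3, h4, h5, hr, hv, hD]
    simp only [violation, varNe, Test.holds, IExpr.eval, RExpr.eval, he, h2, h3, h4, h5,
      Int.cast_zero, Equation]
    tauto
  refine .ite (fun h => .isetVar ?_) (fun h => .skip ?_)
  · refine ⟨⟨⟨⟨⟨by simpa using h0, by simpa using hr⟩, by simpa using h2, by simpa using h3,
      by simpa using hv⟩, by simpa using h4⟩, by simpa using h5⟩, .inr ⟨fun hn => ?_, ?_⟩⟩
    · exact hviol.1 h hn.2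
    · simp [IExpr.eval]
  · rw [hviol, not_not] at h
    refine ⟨⟨⟨⟨⟨h0, hr⟩, h2, h3, hv⟩, h4⟩, h5⟩, ?_⟩
    rcases hb with ⟨hb, e⟩ | ⟨hb, e⟩
    · exact .inl ⟨⟨hb, h⟩, e⟩
    · exact .inr ⟨fun hn => hb hn.1, e⟩

end QTSP

/-! ### The tested equations characterize linearizations; assembly of the cases. -/

namespace QTSP

open RealRAM RealRAM.Program Finset

theorem linearizesOn_iff_equation {r : ℕ → ℕ → ℕ → ℕ → ℕ → ℝ} {m : ℕ} (hm : 4 ≤ m)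
    (hP : ∀ a < m, ∀ b < m, r 2 a b 0 0 = insTotal (r 0) m (range m) a b)
    (h1 : ∀ a, r 1 a m 0 0 = 0) (h2 : ∀ b, r 1 m b 0 0 = 0) :
    LinearizesOn (fun a b => r 1 a b 0 0) (r 0) (range (m + 1)) ↔
      ∀ i < m, ∀ j < m, ∀ k < m, ∀ l < m,
        i ≠ j ∧ k ≠ i ∧ k ≠ j ∧ l ≠ i ∧ l ≠ j ∧ k ≠ l → Equation r m i j k l := by
  rw [range_add_one, linearizesOn_insert_iff_residual (c := fun a b => r 1 a b 0 0) notMem_range_self (by rw [card_range]; omega)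
    (fun a _ => h1 a) (fun b _ => h2 b)]
  have hD : ∀ i j, ∀ a < m, ∀ b < m, ((m : ℝ) - 2) * insLin (r 0) m i j a b - r 2 a b 0 0 +
      r 1 a b 0 0 = residual (r 0) (fun a b => r 1 a b 0 0) m (range m) i j a b := by
    intro i j a ha b hb
    rw [residual, hP a ha b hb, card_range]
  have key : ∀ i < m, ∀ j < m, i ≠ j → ((∀ σ : Equiv.Perm ℕ, IsTourOn σ (range m) → σ i = j →
      linOn (residual (r 0) (fun a b => r 1 a b 0 0) m (range m) i j) σ (range m) +
        (((range m).card : ℝ) - 2) * (insConst (r 0) m i j + r 1 i j 0 0) = 0) ↔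
      ∀ k < m, ∀ l < m, k ≠ i → k ≠ j → l ≠ i → l ≠ j → k ≠ l → Equation r m i j k l) := by
    intro i hi j hj hij
    rw [forall_tours_through_iff (mem_range.2 hi) (mem_range.2 hj) hij
      (by rw [card_range]; omega)]
    simp only [mem_range, card_range]
    have hsum : ∀ g : ℕ → ℝ, ∑ t ∈ ((range m).erase i).erase j, g t =
        ∑ t ∈ range m, g t - g i - g j := by
      intro g
      rw [← add_sum_erase (range m) g (mem_range.2 hi), ← add_sum_erase ((range m).erase i) g
        (mem_erase.2 ⟨hij.symm, mem_range.2 hj⟩)]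
      ring
    have hiff : ∀ k < m, ∀ l < m, (Equation r m i j k l ↔
        ((m : ℝ) - 3) * (residual (r 0) (fun a b => r 1 a b 0 0) m (range m) i j k l -
          residual (r 0) (fun a b => r 1 a b 0 0) m (range m) i j k i -
          residual (r 0) (fun a b => r 1 a b 0 0) m (range m) i j j l) +
        ∑ t ∈ ((range m).erase i).erase j,
          (residual (r 0) (fun a b => r 1 a b 0 0) m (range m) i j t i +
          residual (r 0) (fun a b => r 1 a b 0 0) m (range m) i j j t) +
        residual (r 0) (fun a b => r 1 a b 0 0) m (range m) i j i j +
        ((m : ℝ) - 2) * (insConst (r 0) m i j + r 1 i j 0 0) = 0) := by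
      intro k hk l hl
      rw [hsum, sum_congr rfl fun t ht => by rw [← hD i j t (mem_range.1 ht) i hi,
        ← hD i j j hj t (mem_range.1 ht)], ← hD i j k hk l hl, ← hD i j k hk i hi,
        ← hD i j j hj l hl, ← hD i j i hi i hi, ← hD i j j hj i hi, ← hD i j j hj j hj,
        ← hD i j i hi j hj]
      simp only [Equation, sub_sub]
    constructor
    · intro h k hk l hl a1 a2 a3 a4 a5
      exact (hiff k hk l hl).2 (h k hk l hl a1 a2 a3 a4 a5)
    · intro h k hk l hl a1 a2 a3 a4 a5
      exact (hiff k hk l hl).1 (h k hk l hl a1 a2 a3 a4 a5)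
  simp only [mem_range]
  constructor
  · rintro h i hi j hj k hk l hl ⟨hij, a1, a2, a3, a4, a5⟩
    exact (key i hi j hj hij).1 (h i hi j hj hij) k hk l hl a1 a2 a3 a4 a5
  · intro h i hi j hj hij
    exact (key i hi j hj hij).2 fun k hk l hl a1 a2 a3 a4 a5 =>
      h i hi j hj k hk l hl ⟨hij, a1, a2, a3, a4, a5⟩

/-- The program solves the instance `Q` if it ends in the state `s`. -/
def Solves (n : ℕ) (Q : Matrix (Arc n) (Arc n) ℝ) (s : State) : Prop :=
  (Linearizable Q ∧ answer s = 1 ∧ IsLinearization (output n s) Q) ∨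
    (¬ Linearizable Q ∧ answer s = 0)

theorem solves_of_linearizesOn {n : ℕ} (hn : 1 < n) {Q : Matrix (Arc n) (Arc n) ℝ} {s : State}
    (h1 : s.ivar 1 = 1)
    (h : LinearizesOn (fun a b => s.rarr 1 a b 0 0) ((input n Q).rarr 0) (range n)) :
    Solves n Q s :=
  have := (isLinearization_iff hn Q _).2 h
  .inl ⟨⟨_, this⟩, h1, this⟩

theorem linearizesOn_range_two {c : ℕ → ℕ → ℝ} {q : ℕ → ℕ → ℕ → ℕ → ℝ}
    (h01 : c 0 1 = q 0 1 0 1 + q 0 1 1 0 + (q 1 0 0 1 + q 1 0 1 0)) (h10 : c 1 0 = 0) :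
    LinearizesOn c q (range 2) := by
  intro τ hτ
  have h0 : τ 0 ≠ 0 := hτ.ne (by simp) (by simp)
  have h1 : τ 1 ≠ 1 := hτ.ne (by simp) (by simp)
  have h0' := mem_range.1 (hτ.mem (a := 0) (by simp))
  have h1' := mem_range.1 (hτ.mem (a := 1) (by simp))
  have e0 : τ 0 = 1 := by omega
  have e1 : τ 1 = 0 := by omega
  simp only [quadOn, linOn, sum_range_succ, sum_range_zero, e0, e1, h01, h10]
  ring

theorem reaches_linearizationProgram (n : ℕ) (Q : Matrix (Arc n) (Arc n) ℝ) :
    Reaches n linearizationProgram (Solves n Q) (input n Q) := by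
  set q := (input n Q).rarr 0 with hq
  have hc0 : ∀ i j, (input n Q).rarr 1 i j 0 0 = 0 := fun i j => by simp [input]
  have h00 : (input n Q).ivar 0 = n := by simp [input]
  refine .seq (.isetVar (.ite (fun hn => .skip ?_) fun hn => .ite (fun hn2 => .rsetArr ?_)
    fun hn2 => ?_))
  · have hn : n < 2 := by simpa [Test.holds, IExpr.eval, h00] using hn
    exact .inl ⟨⟨0, fun τ => (not_tour_of_lt_two hn τ).elim⟩, by simp [answer, IExpr.eval],
      fun τ => (not_tour_of_lt_two hn τ).elim⟩
  -- Two nodes are separate because the candidate would divide by m − 1 = 0.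
  · have hn2 : n = 2 := by simpa [Test.holds, IExpr.eval, h00] using hn2
    refine solves_of_linearizesOn (by omega) (by simp [IExpr.eval]) ?_
    have hr2 : range n = range 2 := by rw [hn2]
    rw [hr2, ← hq]
    refine linearizesOn_range_two ?_ ?_
    · simp [setAt, IExpr.eval, RExpr.eval, qE, hq]
    · simp [setAt, IExpr.eval, hc0]
  · have hn : 1 < n := by simpa [Test.holds, IExpr.eval, h00] using hn
    have hn2 : n ≠ 2 := by simpa [Test.holds, IExpr.eval, h00] using hn2
    obtain ⟨m, rfl⟩ : ∃ m, n = m + 1 := ⟨n - 1, by omega⟩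
    refine .seq (reaches_totalProgram (by simpa using h00) (by simp [IExpr.eval]) hq.symm hc0
      fun s a0 a1 aq ac aP => .seq (reaches_candidateProgram a0 a1 aq rfl ac
      fun s' b0 b1 bq bP bc => ?_))
    simp only [Nat.add_sub_cancel] at aP bc
    set c : ℕ → ℕ → ℝ := fun a b => s'.rarr 1 a b 0 0 with hc
    -- Row and column `m` of the table are never written, so the initial zeros provide the
    -- normalization.
    have hz1 : ∀ a, s'.rarr 1 a m 0 0 = 0 := fun a => by rw [bc, if_neg (by omega)]
    have hz2 : ∀ b, s'.rarr 1 m b 0 0 = 0 := fun b => by rw [bc, if_neg (by omega)]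
    have hcand : ∀ i ∈ range m, ∀ j ∈ range m, i ≠ j → ∃ σ : Equiv.Perm ℕ,
        IsTourOn σ (range m) ∧ σ i = j ∧ c i j = candidate q m (range m) σ i j := by
      intro i hi j hj hij
      rw [mem_range] at hi hj
      obtain ⟨σ, h1, h2, h3⟩ := exists_candidate_eq aP (by omega) hi hj hij
      exact ⟨σ, h1, h2, by rw [← h3, hc]; simp only [bc, hi, hj, and_self, if_true]⟩
    have hS : 1 < (range m).card := by rw [card_range]; omega
    refine .ite (fun h5 => .skip ?_) fun h5 => ?_
    · have h5 : m + 1 < 5 := by simpa [Test.holds, IExpr.eval, b0] using h5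
      refine solves_of_linearizesOn (by omega) b1 ?_
      rw [range_add_one]
      exact linearizesOn_of_card_le_three notMem_range_self hS (by rw [card_range]; omega)
        (fun a _ => hz1 a) (fun b _ => hz2 b) hcand
    · have h5 : 5 ≤ m + 1 := by simpa [Test.holds, IExpr.eval, b0] using h5
      refine reaches_checkProgram b0 b1 rfl fun s'' hr hf => ?_
      rw [Nat.add_sub_cancel, ← linearizesOn_iff_equation (by omega)
        (by rw [bq, bP]; exact aP) hz1 hz2, bq] at hf
      rcases hf with ⟨h, e⟩ | ⟨h, e⟩
      · refine solves_of_linearizesOn (by omega) e ?_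
        rw [hr]
        exact h
      -- A failed test refutes every linearization, since the existence of one would make the
      -- candidate a linearization too.
      · refine .inr ⟨fun hl => h ?_, e⟩
        obtain ⟨C, hC⟩ := hl.exists_linearizesOn (by omega)
        rw [range_add_one] at hC ⊢
        exact linearizesOn_of_candidate notMem_range_self hS (fun a _ => hz1 a)
          (fun b _ => hz2 b) hcand hC

end QTSP

theorem mainTheorem2 :
    ∃ (p : RealRAM.Program) (T : ℕ → ℕ),
      ((fun n : ℕ => (T n : ℝ)) =O[Filter.atTop] (fun n : ℕ => (n : ℝ) ^ 5)) ∧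
      ∀ (n : ℕ) (Q : Matrix (QTSP.Arc n) (QTSP.Arc n) ℝ),
        ∃ (t : ℕ) (s : RealRAM.State),
          RealRAM.Run p (QTSP.input n Q) t s ∧ t ≤ T n ∧
          ((QTSP.Linearizable Q ∧ QTSP.answer s = 1 ∧
              QTSP.IsLinearization (QTSP.output n s) Q) ∨
            (¬ QTSP.Linearizable Q ∧ QTSP.answer s = 0)) :=
  ⟨QTSP.linearizationProgram, fun n => QTSP.linearizationProgram.bound n,
    QTSP.linearizationProgram.isBigO_bound QTSP.depth_linearizationProgram,
    QTSP.reaches_linearizationProgram⟩
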